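/- **Setting.** Let $s,t\ge 0$, let $m_1,\dots,m_s\ge 1$ be integers, $\mathbb Z_{\mathbf m}=\prod_a\mathbb Z/m_a$, and let $\xi_a\in\mathbb C$ be a primitive $m_a$-th root of unity. For $\mathbf x\in\mathbb Z_{\mathbf m}$ write $\boldsymbol\xi^{\mathbf x}=\prod_a\xi_a^{x_a}$, and for $\mathbf u,\mathbf d\in\mathbb Z_{\mathbf m}$ let $\mathbf u\cdot\mathbf d=(u_ad_a)_a$. Let $\mathbf d_k,\mathbf u_k\in\mathbb Z_{\mathbf m}$ ($1\le k\le t$) satisfy $\boldsymbol\xi^{\mathbf u_k\cdot\mathbf d_k}=-1$ and $\boldsymbol\xi^{\mathbf u_k\cdot\mathbf d_l}\boldsymbol\xi^{\mathbf u_l\cdot\mathbf d_k}=1$ for $k\ne l$. The Nenciu type Hopf algebra $H=H(\mathbf m,t,\mathbf d,\mathbf u)$ is the $\mathbb C$-algebra generated by $K_1,\dots,K_s,X_1,\dots,X_t$ with relations $$K_a^{m_a}=1,\quad K_aK_b=K_bK_a,\quad X_k^2=0,\quad K_aX_k=\xi_a^{d_{ka}}X_kK_a,\quad X_kX_l=\boldsymbol\xi^{\mathbf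 u_k\cdot\mathbf d_l}X_lX_k\ (k\neq l),$$ with $K_a$ grouplike, $\Delta(X_k)=1\otimes X_k+X_k\otimes L_k$ where $L_k=\mathbf K^{\mathbf u_k}$, $\varepsilon(X_k)=0$, $S(X_k)=-X_kL_k^{-1}$. Here $\mathbf K^{\mathbf v}=\prod_aK_a^{v_a}$ for $\mathbf v\in\mathbb Z_{\mathbf m}$. The adjoint representation $(H,\rhd)$ is $H$ with $h\rhd x=\sum h_{(1)}xS(h_{(2)})$. For $\mathbf p\in\mathbb Z_{\mathbf m}$ let $\omega_{\mathbf p}=\prod_a\frac1{m_a}\sum_{j=0}^{m_a-1}\xi_a^{-jp_a}K_a^j$, and for $\mathbf r\in\{0,1\}^t$ let $\mathbf X^{\mathbf r}=X_1^{r_1}\cdots X_t^{r_t}$ and $\mathbf L^{-\mathbf r}=\prod_kL_k^{-r_k}$. Under left multiplication put $P_{\mathbf p}=H\omega_{\mathbf p}$, $V^{\mathbf r}_{\mathbf p}=H\mathbf X^{\mathbf r}\omega_{\mathbf p}\subseteq P_{\mathbf p}$ and $S_{\mathbf p}=V^{(1,\dots,1)}_{\mathbf p}$. For $\mathbf w\in\mathbb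 Z_{\mathbf m}$ let $\mathbf r(\mathbf w)\in\{0,1\}^t$ be given by $r(\mathbf w)_k=1$ iff $X_k\mathbf K^{\mathbf w}=\mathbf K^{\mathbf w}X_k$. For $\mathbf r\in\{0,1\}^t$ let $\mathcal L_{\mathbf r}$ be the multiset of the elements $\mathbf l(\mathbf c)=\sum_kc_k\mathbf d_k\in\mathbb Z_{\mathbf m}$, one for each $\mathbf c\in\{0,1\}^t$ with $\mathbf c\le\mathbf r$, and let $\mathcal L=\mathcal L_{(1,\dots,1)}$, which has $2^t$ members. The contribution $C_{\mathbf w}$ of $\mathbf K^{\mathbf w}$ is the submodule of $(H,\rhd)$ generated by the monomials $\mathbf X^{\mathbf a}\mathbf L^{-\mathbf a}\mathbf K^{\mathbf w}$, $\mathbf a\in\{0,1\}^t$. **Theorem.** There is an isomorphism of $H$-modules $$(H,\rhd)\;\cong\;\bigoplus_{\mathbf v\in\mathbb Z_{\mathbf m}}\ \bigoplus_{\mathbf l\in\mathcal L_{\mathbf r(\mathbf v)}}V^{\mathbf r(\mathbf v)}_{-\mathbf l},$$ and all the summands $V^{\mathbf r(\mathbf v)}_{-\mathbf l}$ are indecomposable.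 More precisely, $(H,\rhd)$ is the internal direct sum of the submodules $C_{\mathbf w}$, $\mathbf w\in\mathbb Z_{\mathbf m}$, and $C_{\mathbf w}\cong\bigoplus_{\mathbf l\in\mathcal L_{\mathbf r(\mathbf w)}}V^{\mathbf r(\mathbf w)}_{-\mathbf l}$ for every $\mathbf w$. In particular: 1. if $\mathbf K^{\mathbf w}$ commutes with no $X_k$, then $C_{\mathbf w}\cong P_{\mathbf 0}$, and $P_{\mathbf 0}$ is projective; 2. if $\mathbf K^{\mathbf w}$ is central in $H$, then $C_{\mathbf w}\cong\bigoplus_{\mathbf l\in\mathcal L}S_{-\mathbf l}$, a sum of $2^t$ modules; every $S_{\mathbf p}$ is simple of dimension one over $\mathbb C$. Equivalently, in terms of heads, $C_{\mathbf w}\cong\bigoplus_{\mathbf l\in\mathcal L}P_{\mathbf l}/\operatorname{Rad}P_{\mathbf l}$. -/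

import Mathlib

open scoped TensorProduct DirectSum

noncomputable section

/-! ## The adjoint representation of a Hopf algebra, indecomposable modules -/

section General

variable (R : Type*) (A : Type*) [CommRing R] [Ring A] [HopfAlgebra R A]

/-- Right multiplication by the antipode, `h ↦ (x ↦ x * S(h))`, as an algebra homomorphism. -/
def HopfAlgebra.rmulAntipode : A →ₐ[R] Module.End R A :=
  (Algebra.lsmul R R A : Aᵐᵒᵖ →ₐ[R] Module.End R A).comp (HopfAlgebra.antipodeAlgHomOp R A)

/-- The (left) adjoint action `h ▷ x = ∑ h₍₁₎ * x * S(h₍₂₎)`, as an algebra homomorphism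
`A → End_R(A)`; see `HopfAlgebra.adjointAction_apply`. -/
def HopfAlgebra.adjointAction : A →ₐ[R] Module.End R A :=
  (Algebra.TensorProduct.lift (Algebra.lmul R A) (HopfAlgebra.rmulAntipode R A)
    (fun a b => by
      ext x
      simp [HopfAlgebra.rmulAntipode, HopfAlgebra.antipodeAlgHomOp, mul_assoc])).comp
    (Bialgebra.comulAlgHom R A)

theorem HopfAlgebra.adjointAction_apply {ι : Type*} (h x : A) (r : Coalgebra.Repr R h ι) :
    HopfAlgebra.adjointAction R A h x =
      ∑ i ∈ r.index, r.left i * x * HopfAlgebra.antipode R (r.right i) := by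
  have : Coalgebra.comul (R := R) h = ∑ i ∈ r.index, r.left i ⊗ₜ[R] r.right i := r.eq.symm
  simp [HopfAlgebra.adjointAction, HopfAlgebra.rmulAntipode, HopfAlgebra.antipodeAlgHomOp, this,
    mul_assoc]

/-- The underlying space of the adjoint representation `(A, ▷)`: a copy of `A`. -/
def AdjointRep (R : Type*) (A : Type*) [CommRing R] [Ring A] [HopfAlgebra R A] : Type _ := A

instance : AddCommGroup (AdjointRep R A) := inferInstanceAs (AddCommGroup A)

instance : Module R (AdjointRep R A) := inferInstanceAs (Module R A)

/-- The element `x` of `A`, seen in `(A, ▷)`. -/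
def AdjointRep.of : A ≃ₗ[R] AdjointRep R A := LinearEquiv.refl R A

/-- `A` acts on `(A, ▷)` by `h • x = h ▷ x`. -/
instance : Module A (AdjointRep R A) where
  smul h x := HopfAlgebra.adjointAction R A h x
  one_smul x := by
    change HopfAlgebra.adjointAction R A 1 x = x
    rw [map_one]; rfl
  mul_smul a b x := by
    change HopfAlgebra.adjointAction R A (a * b) x = _
    rw [map_mul]; rfl
  smul_zero a := map_zero (HopfAlgebra.adjointAction R A a)
  smul_add a x y := map_add (HopfAlgebra.adjointAction R A a) x y
  add_smul a b x := by
    change HopfAlgebra.adjointAction R A (a + b) x = _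
    rw [map_add]; rfl
  zero_smul x := by
    change HopfAlgebra.adjointAction R A 0 x = _
    rw [map_zero]; rfl

theorem AdjointRep.smul_of (h x : A) :
    h • AdjointRep.of R A x = AdjointRep.of R A (HopfAlgebra.adjointAction R A h x) := rfl

/-- A module is indecomposable if it is nonzero and is not the direct sum of two nonzero
submodules. -/
def Module.IsIndecomposable (A M : Type*) [Ring A] [AddCommGroup M] [Module A M] : Prop :=
  Nontrivial M ∧ ∀ N N' : Submodule A M, IsCompl N N' → N = ⊥ ∨ N' = ⊥

end General

/-! ## Nenciu type Hopf algebras `H(m, t, d, u)` -/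

/-- The data defining a Nenciu type Hopf algebra with `s` grouplike and `t` nilpotent generators:
the orders `m a` of the grouplike generators, primitive `m a`-th roots of unity `ξ a`, and the
matrices `d`, `u`, with rows `d k, u k ∈ ℤ_m = ∏ₐ ℤ/m_a`, such that
`ξ^{u_k · d_k} = -1` and `ξ^{u_k · d_l} ξ^{u_l · d_k} = 1` for `k ≠ l`
(here `ξ^{u · d} = ∏ₐ ξ_a ^ (u_a d_a)`). -/
structure NenciuDatum (s t : ℕ) where
  /-- orders of the grouplike generators -/
  m : Fin s → ℕ
  m_pos : ∀ a, 0 < m a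
  /-- the roots of unity -/
  ξ : Fin s → ℂ
  ξ_prim : ∀ a, IsPrimitiveRoot (ξ a) (m a)
  /-- commutation exponents of `K_a` and `X_k` -/
  d : Fin t → (a : Fin s) → ZMod (m a)
  /-- exponents of the grouplike `L_k = K^{u_k}` -/
  u : Fin t → (a : Fin s) → ZMod (m a)
  self_cond : ∀ k, ∏ a, ξ a ^ (u k a * d k a).val = -1
  pair_cond : ∀ k l, k ≠ l →
    (∏ a, ξ a ^ (u k a * d l a).val) * (∏ a, ξ a ^ (u l a * d k a).val) = 1

namespace NenciuDatum

variable {s t : ℕ} (D : NenciuDatum s t)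

instance (a : Fin s) : NeZero (D.m a) := ⟨(D.m_pos a).ne'⟩

/-- The group `ℤ_m = ∏ₐ ℤ/m_a`. -/
abbrev Z : Type := (a : Fin s) → ZMod (D.m a)

/-- `ξ^x = ∏ₐ ξ_a ^ x_a` for `x ∈ ℤ_m`. -/
def xi (x : D.Z) : ℂ := ∏ a, D.ξ a ^ (x a).val

/-- The defining relations; `Sum.inl a` is the generator `K_a`, `Sum.inr k` the generator `X_k`. -/
inductive Rel : FreeAlgebra ℂ (Fin s ⊕ Fin t) → FreeAlgebra ℂ (Fin s ⊕ Fin t) → Prop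
  | K_pow (a : Fin s) : Rel (FreeAlgebra.ι ℂ (Sum.inl a) ^ D.m a) 1
  | K_comm (a b : Fin s) :
      Rel (FreeAlgebra.ι ℂ (Sum.inl a) * FreeAlgebra.ι ℂ (Sum.inl b))
        (FreeAlgebra.ι ℂ (Sum.inl b) * FreeAlgebra.ι ℂ (Sum.inl a))
  | X_sq (k : Fin t) : Rel (FreeAlgebra.ι ℂ (Sum.inr k) ^ 2) 0
  | K_X (a : Fin s) (k : Fin t) :
      Rel (FreeAlgebra.ι ℂ (Sum.inl a) * FreeAlgebra.ι ℂ (Sum.inr k))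
        (D.ξ a ^ (D.d k a).val •
          (FreeAlgebra.ι ℂ (Sum.inr k) * FreeAlgebra.ι ℂ (Sum.inl a)))
  | X_X (k l : Fin t) (h : k ≠ l) :
      Rel (FreeAlgebra.ι ℂ (Sum.inr k) * FreeAlgebra.ι ℂ (Sum.inr l))
        (D.xi (D.u k * D.d l) •
          (FreeAlgebra.ι ℂ (Sum.inr l) * FreeAlgebra.ι ℂ (Sum.inr k)))

/-- The Nenciu type Hopf algebra `H(m, t, d, u)`, as an algebra. -/
def H : Type := RingQuot D.Rel

instance : Ring D.H := inferInstanceAs (Ring (RingQuot D.Rel))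
instance : Algebra ℂ D.H := inferInstanceAs (Algebra ℂ (RingQuot D.Rel))

/-- The canonical projection from the free algebra. -/
def proj : FreeAlgebra ℂ (Fin s ⊕ Fin t) →ₐ[ℂ] D.H := RingQuot.mkAlgHom ℂ D.Rel

/-- The grouplike generators. -/
def K (a : Fin s) : D.H := D.proj (FreeAlgebra.ι ℂ (Sum.inl a))

/-- The nilpotent generators. -/
def X (k : Fin t) : D.H := D.proj (FreeAlgebra.ι ℂ (Sum.inr k))

/-- `K^v = ∏ₐ K_a ^ v_a` for `v ∈ ℤ_m`. -/
def Kpow (v : D.Z) : D.H := ((List.finRange s).map fun a => D.K a ^ (v a).val).prod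

/-- `L_k = K^{u_k}`. -/
def L (k : Fin t) : D.H := D.Kpow (D.u k)

theorem K_pow (a : Fin s) : D.K a ^ D.m a = 1 := by
  simpa [K, proj] using! RingQuot.mkAlgHom_rel ℂ (Rel.K_pow (D := D) a)

theorem K_comm (a b : Fin s) : D.K a * D.K b = D.K b * D.K a := by
  simpa [K, proj] using! RingQuot.mkAlgHom_rel ℂ (Rel.K_comm (D := D) a b)

theorem X_sq (k : Fin t) : D.X k * D.X k = 0 := by
  simpa [X, proj, pow_two] using! RingQuot.mkAlgHom_rel ℂ (Rel.X_sq (D := D) k)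

theorem K_X (a : Fin s) (k : Fin t) :
    D.K a * D.X k = D.ξ a ^ (D.d k a).val • (D.X k * D.K a) := by
  simpa [K, X, proj] using! RingQuot.mkAlgHom_rel ℂ (Rel.K_X (D := D) a k)

theorem X_X (k l : Fin t) (h : k ≠ l) :
    D.X k * D.X l = D.xi (D.u k * D.d l) • (D.X l * D.X k) := by
  simpa [X, proj] using! RingQuot.mkAlgHom_rel ℂ (Rel.X_X (D := D) k l h)

/-- The defining relations of `H`, for elements `κ a`, `χ k` of an arbitrary algebra. -/
structure Relations {B : Type*} [Semiring B] [Algebra ℂ B] (κ : Fin s → B) (χ : Fin t → B) :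
    Prop where
  K_pow : ∀ a, κ a ^ D.m a = 1
  K_comm : ∀ a b, κ a * κ b = κ b * κ a
  X_sq : ∀ k, χ k * χ k = 0
  K_X : ∀ a k, κ a * χ k = D.ξ a ^ (D.d k a).val • (χ k * κ a)
  X_X : ∀ k l, k ≠ l → χ k * χ l = D.xi (D.u k * D.d l) • (χ l * χ k)

section lift

variable {B : Type*} [Semiring B] [Algebra ℂ B] {κ : Fin s → B} {χ : Fin t → B}

/-- Universal property of `H`: construct an algebra homomorphism from images of the generators
satisfying the relations. -/
def lift (h : D.Relations κ χ) : D.H →ₐ[ℂ] B :=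
  RingQuot.liftAlgHom ℂ ⟨FreeAlgebra.lift ℂ (Sum.elim κ χ), by
    intro x y hxy
    induction hxy with
    | K_pow a => simpa using h.K_pow a
    | K_comm a b => simpa using h.K_comm a b
    | X_sq k => simpa [pow_two] using h.X_sq k
    | K_X a k => simpa using h.K_X a k
    | X_X k l hkl => simpa using h.X_X k l hkl⟩

theorem lift_K (h : D.Relations κ χ) (a : Fin s) : D.lift h (D.K a) = κ a := by
  unfold lift K proj
  erw [RingQuot.liftAlgHom_mkAlgHom_apply]
  simp

theorem lift_X (h : D.Relations κ χ) (k : Fin t) : D.lift h (D.X k) = χ k := by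
  unfold lift X proj
  erw [RingQuot.liftAlgHom_mkAlgHom_apply]
  simp

end lift

theorem algHom_ext {B : Type*} [Semiring B] [Algebra ℂ B] {f g : D.H →ₐ[ℂ] B}
    (hK : ∀ a, f (D.K a) = g (D.K a)) (hX : ∀ k, f (D.X k) = g (D.X k)) : f = g := by
  apply RingQuot.ringQuot_ext'
  apply FreeAlgebra.hom_ext
  funext i
  rcases i with a | k
  · exact hK a
  · exact hX k

/-- `H` is generated by the `K_a` and `X_k`. -/
theorem gen_induction {p : D.H → Prop} (hK : ∀ a, p (D.K a)) (hX : ∀ k, p (D.X k))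
    (hc : ∀ c : ℂ, p (algebraMap ℂ D.H c)) (hadd : ∀ x y, p x → p y → p (x + y))
    (hmul : ∀ x y, p x → p y → p (x * y)) (x : D.H) : p x := by
  obtain ⟨y, rfl⟩ : ∃ y, D.proj y = x := RingQuot.mkAlgHom_surjective ℂ D.Rel x
  induction y using FreeAlgebra.induction with
  | grade0 r => simpa using hc r
  | grade1 i =>
    rcases i with a | k
    · exact hK a
    · exact hX k
  | mul a b ha hb => rw [map_mul]; exact hmul _ _ ha hb
  | add a b ha hb => rw [map_add]; exact hadd _ _ ha hb

/-! Commutation rules -/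

theorem root_pow_mod (a : Fin s) (n : ℕ) : D.ξ a ^ (n % D.m a) = D.ξ a ^ n :=
  (pow_eq_pow_mod n (D.ξ_prim a).pow_eq_one).symm

theorem xi_add (x y : D.Z) : D.xi (x + y) = D.xi x * D.xi y := by
  simp only [xi, ← Finset.prod_mul_distrib]
  refine Finset.prod_congr rfl fun a _ => ?_
  rw [Pi.add_apply, ZMod.val_add, root_pow_mod, pow_add]

theorem xi_zero : D.xi 0 = 1 := by simp [xi]

theorem xi_neg_mul (x : D.Z) : D.xi (-x) * D.xi x = 1 := by
  rw [← xi_add, neg_add_cancel, xi_zero]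

theorem xi_self (k : Fin t) : D.xi (D.u k * D.d k) = -1 := D.self_cond k

theorem xi_pair (k l : Fin t) (h : k ≠ l) :
    D.xi (D.u k * D.d l) * D.xi (D.u l * D.d k) = 1 := D.pair_cond k l h

theorem Kn_X (a : Fin s) (k : Fin t) (n : ℕ) :
    D.K a ^ n * D.X k = D.ξ a ^ (n * (D.d k a).val) • (D.X k * D.K a ^ n) := by
  induction n with
  | zero => simp
  | succ n ih =>
    rw [pow_succ', mul_assoc, ih, mul_smul_comm, ← mul_assoc, K_X, smul_mul_assoc, smul_smul,
      mul_assoc, ← pow_add]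
    congr 2; ring

theorem Kpow_X (v : D.Z) (k : Fin t) :
    D.Kpow v * D.X k = D.xi (v * D.d k) • (D.X k * D.Kpow v) := by
  have key : ∀ l : List (Fin s), (l.map fun a => D.K a ^ (v a).val).prod * D.X k =
      (l.map fun a => D.ξ a ^ ((v * D.d k) a).val).prod •
        (D.X k * (l.map fun a => D.K a ^ (v a).val).prod) := by
    intro l
    induction l with
    | nil => simp
    | cons a l ih =>
      have hx : D.ξ a ^ ((v * D.d k) a).val = D.ξ a ^ ((v a).val * (D.d k a).val) := by
        rw [Pi.mul_apply, ZMod.val_mul, root_pow_mod]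
      simp only [List.map_cons, List.prod_cons]
      rw [hx, mul_assoc, ih, mul_smul_comm, ← mul_assoc, Kn_X, smul_mul_assoc, smul_smul,
        mul_assoc, mul_comm (List.prod _)]
  have := key (List.finRange s)
  rwa [← Fin.prod_univ_def] at this

theorem K_commute (a b : Fin s) : Commute (D.K a) (D.K b) := D.K_comm a b

theorem K_commute_Kpow (a : Fin s) (v : D.Z) : Commute (D.K a) (D.Kpow v) := by
  apply Commute.list_prod_right
  intro x hx
  obtain ⟨b, -, rfl⟩ := List.mem_map.1 hx
  exact (D.K_commute a b).pow_right _

theorem Kpow_commute (v w : D.Z) : Commute (D.Kpow v) (D.Kpow w) := by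
  apply Commute.list_prod_left
  intro x hx
  obtain ⟨b, -, rfl⟩ := List.mem_map.1 hx
  exact (D.K_commute_Kpow b w).pow_left _

theorem Kpow_add (v w : D.Z) : D.Kpow (v + w) = D.Kpow v * D.Kpow w := by
  have key : ∀ l : List (Fin s), (l.map fun a => D.K a ^ ((v + w) a).val).prod =
      (l.map fun a => D.K a ^ (v a).val).prod * (l.map fun a => D.K a ^ (w a).val).prod := by
    intro l
    induction l with
    | nil => simp
    | cons a l ih =>
      have hx : D.K a ^ ((v + w) a).val = D.K a ^ (v a).val * D.K a ^ (w a).val := by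
        rw [Pi.add_apply, ZMod.val_add, ← pow_eq_pow_mod _ (D.K_pow a), pow_add]
      have hc : Commute (D.K a ^ (w a).val) (l.map fun a => D.K a ^ (v a).val).prod := by
        apply Commute.list_prod_right
        intro x hx
        obtain ⟨b, -, rfl⟩ := List.mem_map.1 hx
        exact (D.K_commute a b).pow_pow _ _
      simp only [List.map_cons, List.prod_cons]
      rw [hx, ih, mul_assoc, mul_assoc, ← mul_assoc (D.K a ^ (w a).val), hc.eq, mul_assoc]
  exact key _

theorem Kpow_zero : D.Kpow 0 = 1 := by simp [Kpow]

theorem Kpow_neg_mul (v : D.Z) : D.Kpow (-v) * D.Kpow v = 1 := by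
  rw [← Kpow_add, neg_add_cancel, Kpow_zero]

theorem Kpow_mul_neg (v : D.Z) : D.Kpow v * D.Kpow (-v) = 1 := by
  rw [← Kpow_add, add_neg_cancel, Kpow_zero]

/-! Hopf algebra structure -/

theorem comul_relations : D.Relations (fun a => D.K a ⊗ₜ[ℂ] D.K a)
    (fun k => 1 ⊗ₜ[ℂ] D.X k + D.X k ⊗ₜ[ℂ] D.L k) where
  K_pow := fun a => by
    simp [Algebra.TensorProduct.tmul_pow, K_pow, Algebra.TensorProduct.one_def]
  K_comm := fun a b => by simp [Algebra.TensorProduct.tmul_mul_tmul, D.K_comm a b]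
  X_sq := fun k => by
    simp [mul_add, add_mul, Algebra.TensorProduct.tmul_mul_tmul, X_sq, L, Kpow_X, xi_self,
      TensorProduct.tmul_neg]
  K_X := fun a k => by
    have := (D.K_commute_Kpow a (D.u k)).eq
    simp [mul_add, add_mul, Algebra.TensorProduct.tmul_mul_tmul, K_X, L, this,
      TensorProduct.smul_tmul']
  X_X := fun k l h => by
    have hp := D.xi_pair k l h
    have e1 := D.X_X k l h
    have e3 : D.X k * D.Kpow (D.u l) =
        D.xi (D.u k * D.d l) • (D.Kpow (D.u l) * D.X k) := by
      rw [Kpow_X, smul_smul, hp, one_smul]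
    simp only [mul_add, add_mul, Algebra.TensorProduct.tmul_mul_tmul, L, e1, Kpow_X D (D.u k) l,
      e3, one_mul, mul_one, smul_add, TensorProduct.tmul_smul, TensorProduct.smul_tmul',
      (D.Kpow_commute (D.u k) (D.u l)).eq]
    abel

/-- The comultiplication: `Δ(K_a) = K_a ⊗ K_a`, `Δ(X_k) = 1 ⊗ X_k + X_k ⊗ L_k`. -/
def comulHom : D.H →ₐ[ℂ] D.H ⊗[ℂ] D.H := D.lift D.comul_relations

theorem counit_relations : D.Relations (fun _ => (1 : ℂ)) (fun _ => (0 : ℂ)) where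
  K_pow := by simp
  K_comm := by simp
  X_sq := by simp
  K_X := by simp
  X_X := by simp

/-- The counit: `ε(K_a) = 1`, `ε(X_k) = 0`. -/
def counitHom : D.H →ₐ[ℂ] ℂ := D.lift D.counit_relations

theorem comulHom_K (a : Fin s) : D.comulHom (D.K a) = D.K a ⊗ₜ D.K a :=
  D.lift_K D.comul_relations a

theorem comulHom_X (k : Fin t) : D.comulHom (D.X k) = 1 ⊗ₜ D.X k + D.X k ⊗ₜ D.L k :=
  D.lift_X D.comul_relations k

theorem counitHom_K (a : Fin s) : D.counitHom (D.K a) = 1 := D.lift_K D.counit_relations a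

theorem counitHom_X (k : Fin t) : D.counitHom (D.X k) = 0 := D.lift_X D.counit_relations k

theorem comulHom_Kpow (v : D.Z) : D.comulHom (D.Kpow v) = D.Kpow v ⊗ₜ D.Kpow v := by
  have key : ∀ l : List (Fin s), D.comulHom (l.map fun a => D.K a ^ (v a).val).prod =
      (l.map fun a => D.K a ^ (v a).val).prod ⊗ₜ (l.map fun a => D.K a ^ (v a).val).prod := by
    intro l
    induction l with
    | nil => simp [Algebra.TensorProduct.one_def]
    | cons a l ih =>
      simp only [List.map_cons, List.prod_cons]
      rw [map_mul, ih, map_pow, comulHom_K, Algebra.TensorProduct.tmul_pow,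
        Algebra.TensorProduct.tmul_mul_tmul]
  exact key _

theorem counitHom_Kpow (v : D.Z) : D.counitHom (D.Kpow v) = 1 := by
  rw [Kpow, map_list_prod]
  apply List.prod_eq_one
  intro x hx
  obtain ⟨y, hy, rfl⟩ := List.mem_map.1 hx
  obtain ⟨b, -, rfl⟩ := List.mem_map.1 hy
  simp [counitHom_K]

instance : Bialgebra ℂ D.H :=
  Bialgebra.ofAlgHom D.comulHom D.counitHom
    (by
      apply D.algHom_ext
      · intro a; simp [comulHom_K]
      · intro k
        simp [comulHom_X, comulHom_Kpow, L, TensorProduct.add_tmul, TensorProduct.tmul_add,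
          Algebra.TensorProduct.one_def, add_assoc])
    (by
      apply D.algHom_ext
      · intro a; simp [comulHom_K, counitHom_K]
      · intro k; simp [comulHom_X, counitHom_X])
    (by
      apply D.algHom_ext
      · intro a; simp [comulHom_K, counitHom_K]
      · intro k; simp [comulHom_X, counitHom_X, counitHom_Kpow, L])

theorem K_pow_pred_mul (a : Fin s) : D.K a ^ (D.m a - 1) * D.K a = 1 := by
  rw [← pow_succ, Nat.sub_add_cancel (D.m_pos a), K_pow]

theorem X_mul_K_pred (a : Fin s) (k : Fin t) :
    D.X k * D.K a ^ (D.m a - 1) =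
      D.ξ a ^ (D.d k a).val • (D.K a ^ (D.m a - 1) * D.X k) := by
  have h1 : D.K a * D.K a ^ (D.m a - 1) = 1 := by
    rw [← pow_succ', Nat.sub_add_cancel (D.m_pos a), K_pow]
  calc D.X k * D.K a ^ (D.m a - 1)
      = D.K a ^ (D.m a - 1) * (D.K a * D.X k) * D.K a ^ (D.m a - 1) := by
        rw [← mul_assoc, K_pow_pred_mul, one_mul]
    _ = _ := by
        rw [K_X, mul_smul_comm, smul_mul_assoc, mul_assoc, mul_assoc, h1, mul_one]

theorem X_mul_Kpow (v : D.Z) (k : Fin t) :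
    D.X k * D.Kpow v = D.xi (-(v * D.d k)) • (D.Kpow v * D.X k) := by
  rw [Kpow_X, smul_smul, xi_neg_mul, one_smul]

open MulOpposite in
theorem antipode_relations : D.Relations (fun a => op (D.K a ^ (D.m a - 1)))
    (fun k => op (-(D.X k * D.Kpow (-D.u k)))) where
  K_pow := fun a => by
    rw [← op_pow, ← pow_mul, mul_comm, pow_mul, K_pow, one_pow, op_one]
  K_comm := fun a b => by
    rw [← op_mul, ← op_mul, ((D.K_commute a b).pow_pow _ _).eq]
  X_sq := fun k => by
    rw [← op_mul, neg_mul_neg, mul_assoc, ← mul_assoc (D.Kpow _), Kpow_X, smul_mul_assoc,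
      mul_smul_comm, mul_assoc, ← mul_assoc (D.X k), X_sq, zero_mul, smul_zero, op_zero]
  K_X := fun a k => by
    rw [← op_mul, ← op_mul, ← op_smul, neg_mul, mul_neg, mul_assoc,
      ← ((D.K_commute_Kpow a (-D.u k)).pow_left _).eq, ← mul_assoc, X_mul_K_pred,
      smul_mul_assoc, mul_assoc, smul_neg]
  X_X := fun k l h => by
    have e : ∀ i j : Fin t, D.X i * D.Kpow (-D.u i) * (D.X j * D.Kpow (-D.u j)) =
        D.xi (-(D.u i * D.d j)) • (D.X i * D.X j * (D.Kpow (-D.u i) * D.Kpow (-D.u j))) := by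
      intro i j
      rw [mul_assoc, ← mul_assoc (D.Kpow _), Kpow_X, smul_mul_assoc, mul_smul_comm, neg_mul]
      simp only [mul_assoc]
    have hp : D.xi (-(D.u l * D.d k)) = D.xi (D.u k * D.d l) := by
      calc D.xi (-(D.u l * D.d k))
          = D.xi (-(D.u l * D.d k)) * (D.xi (D.u k * D.d l) * D.xi (D.u l * D.d k)) := by
            rw [D.xi_pair k l h, mul_one]
        _ = (D.xi (-(D.u l * D.d k)) * D.xi (D.u l * D.d k)) * D.xi (D.u k * D.d l) := by ring
        _ = _ := by rw [xi_neg_mul, one_mul]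
    have hq : D.xi (D.u k * D.d l) * D.xi (-(D.u k * D.d l)) = 1 := by
      rw [mul_comm, xi_neg_mul]
    rw [← op_mul, ← op_mul, ← op_smul, neg_mul_neg, neg_mul_neg, e l k, e k l, hp,
      D.X_X k l h, smul_mul_assoc, smul_smul, smul_smul, hq, one_mul,
      (D.Kpow_commute (-D.u l) (-D.u k)).eq]

/-- The antipode as a homomorphism to the opposite algebra:
`S(K_a) = K_a⁻¹`, `S(X_k) = - X_k L_k⁻¹`. -/
def antipodeHom : D.H →ₐ[ℂ] D.Hᵐᵒᵖ := D.lift D.antipode_relations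

theorem antipodeHom_K (a : Fin s) : (D.antipodeHom (D.K a)).unop = D.K a ^ (D.m a - 1) :=
  congrArg MulOpposite.unop (D.lift_K D.antipode_relations a)

theorem antipodeHom_X (k : Fin t) :
    (D.antipodeHom (D.X k)).unop = -(D.X k * D.Kpow (-D.u k)) :=
  congrArg MulOpposite.unop (D.lift_X D.antipode_relations k)

theorem antipodeHom_Kpow (v : D.Z) : (D.antipodeHom (D.Kpow v)).unop = D.Kpow (-v) := by
  have key : ∀ l : List (Fin s),
      (D.antipodeHom (l.map fun a => D.K a ^ (v a).val).prod).unop *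
        (l.map fun a => D.K a ^ (v a).val).prod = 1 := by
    intro l
    induction l with
    | nil => simp
    | cons a l ih =>
      have h : (D.antipodeHom (D.K a ^ (v a).val)).unop * D.K a ^ (v a).val = 1 := by
        rw [map_pow, MulOpposite.unop_pow, antipodeHom_K,
          ← ((Commute.refl (D.K a)).pow_left _).mul_pow, K_pow_pred_mul, one_pow]
      simp only [List.map_cons, List.prod_cons]
      rw [map_mul, MulOpposite.unop_mul, mul_assoc, ← mul_assoc _ (D.K a ^ _), h, one_mul, ih]
  have h := key (List.finRange s)
  change (D.antipodeHom (D.Kpow v)).unop * D.Kpow v = 1 at h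
  rw [← mul_one (MulOpposite.unop _), ← D.Kpow_mul_neg v, ← mul_assoc, h, one_mul]

/-- The antipode. -/
def antipodeLin : D.H →ₗ[ℂ] D.H :=
  (MulOpposite.opLinearEquiv ℂ).symm.toLinearMap ∘ₗ D.antipodeHom.toLinearMap

theorem antipodeLin_apply (x : D.H) : D.antipodeLin x = (D.antipodeHom x).unop := rfl

theorem antipodeLin_mul (x y : D.H) :
    D.antipodeLin (x * y) = D.antipodeLin y * D.antipodeLin x := by
  simp [antipodeLin_apply]

theorem mul_rTensor_mul (T U : D.H ⊗[ℂ] D.H) (c : ℂ)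
    (h : LinearMap.mul' ℂ D.H (D.antipodeLin.rTensor D.H T) = algebraMap ℂ D.H c) :
    LinearMap.mul' ℂ D.H (D.antipodeLin.rTensor D.H (T * U)) =
      algebraMap ℂ D.H c * LinearMap.mul' ℂ D.H (D.antipodeLin.rTensor D.H U) := by
  have key : ∀ (a b : D.H) (T : D.H ⊗[ℂ] D.H),
      LinearMap.mul' ℂ D.H (D.antipodeLin.rTensor D.H (T * a ⊗ₜ b)) =
        D.antipodeLin a * LinearMap.mul' ℂ D.H (D.antipodeLin.rTensor D.H T) * b := by
    intro a b T
    induction T with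
    | zero => simp
    | tmul x y => simp [Algebra.TensorProduct.tmul_mul_tmul, antipodeLin_mul, mul_assoc]
    | add x y hx hy => simp only [add_mul, map_add, hx, hy, mul_add]
  induction U with
  | zero => simp
  | tmul a b =>
    rw [key, h, ← Algebra.commutes, mul_assoc]
    simp
  | add x y hx hy => simp only [mul_add, map_add, hx, hy]

theorem mul_lTensor_mul (T U : D.H ⊗[ℂ] D.H) (c : ℂ)
    (h : LinearMap.mul' ℂ D.H (D.antipodeLin.lTensor D.H U) = algebraMap ℂ D.H c) :
    LinearMap.mul' ℂ D.H (D.antipodeLin.lTensor D.H (T * U)) =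
      LinearMap.mul' ℂ D.H (D.antipodeLin.lTensor D.H T) * algebraMap ℂ D.H c := by
  have key : ∀ (a b : D.H) (U : D.H ⊗[ℂ] D.H),
      LinearMap.mul' ℂ D.H (D.antipodeLin.lTensor D.H (a ⊗ₜ b * U)) =
        a * LinearMap.mul' ℂ D.H (D.antipodeLin.lTensor D.H U) * D.antipodeLin b := by
    intro a b U
    induction U with
    | zero => simp
    | tmul x y => simp [Algebra.TensorProduct.tmul_mul_tmul, antipodeLin_mul, mul_assoc]
    | add x y hx hy => simp only [add_mul, map_add, hx, hy, mul_add]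
  induction T with
  | zero => simp
  | tmul a b =>
    rw [key, h, ← Algebra.commutes, mul_assoc, Algebra.commutes]
    simp
  | add x y hx hy => simp only [add_mul, map_add, hx, hy]

instance : HopfAlgebra ℂ D.H where
  antipode := D.antipodeLin
  mul_antipode_rTensor_comul := by
    ext x
    change LinearMap.mul' ℂ D.H (D.antipodeLin.rTensor D.H (D.comulHom x)) =
      algebraMap ℂ D.H (D.counitHom x)
    induction x using D.gen_induction with
    | hK a => simp [comulHom_K, counitHom_K, antipodeLin_apply, antipodeHom_K, K_pow_pred_mul]
    | hX k =>
      have h1 : D.antipodeLin 1 = 1 := by simp [antipodeLin_apply]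
      simp [comulHom_X, counitHom_X, antipodeLin_apply, antipodeHom_X, L, mul_assoc, Kpow_neg_mul]
    | hc c => simp [antipodeLin_apply]
    | hadd x y hx hy => simp only [map_add, hx, hy]
    | hmul x y hx hy => rw [map_mul, mul_rTensor_mul D _ _ _ hx, hy, map_mul, map_mul]
  mul_antipode_lTensor_comul := by
    ext x
    change LinearMap.mul' ℂ D.H (D.antipodeLin.lTensor D.H (D.comulHom x)) =
      algebraMap ℂ D.H (D.counitHom x)
    induction x using D.gen_induction with
    | hK a =>
      have : D.K a * D.K a ^ (D.m a - 1) = 1 := by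
        rw [← pow_succ', Nat.sub_add_cancel (D.m_pos a), K_pow]
      simp [comulHom_K, counitHom_K, antipodeLin_apply, antipodeHom_K, this]
    | hX k => simp [comulHom_X, counitHom_X, antipodeLin_apply, antipodeHom_X, L, antipodeHom_Kpow]
    | hc c => simp [antipodeLin_apply]
    | hadd x y hx hy => simp only [map_add, hx, hy]
    | hmul x y hx hy => rw [map_mul, mul_lTensor_mul D _ _ _ hy, hx, map_mul, map_mul]

/-- The adjoint action on generators: `K_a ▷ x = K_a x K_a⁻¹`. -/
theorem adjointAction_K (a : Fin s) (x : D.H) :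
    HopfAlgebra.adjointAction ℂ D.H (D.K a) x = D.K a * x * D.K a ^ (D.m a - 1) := by
  have h : Bialgebra.comulAlgHom ℂ D.H (D.K a) = D.K a ⊗ₜ D.K a := D.comulHom_K a
  have h' : HopfAlgebra.antipode ℂ (D.K a) = D.K a ^ (D.m a - 1) := D.antipodeHom_K a
  simp [HopfAlgebra.adjointAction, HopfAlgebra.rmulAntipode, HopfAlgebra.antipodeAlgHomOp,
    -Bialgebra.comulAlgHom_apply, h, h', mul_assoc, -map_pow, -MulOpposite.op_pow]

/-- The adjoint action on generators: `X_k ▷ x = [X_k, x] L_k⁻¹`. -/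
theorem adjointAction_X (k : Fin t) (x : D.H) :
    HopfAlgebra.adjointAction ℂ D.H (D.X k) x =
      (D.X k * x - x * D.X k) * D.Kpow (-D.u k) := by
  have h : Bialgebra.comulAlgHom ℂ D.H (D.X k) = 1 ⊗ₜ D.X k + D.X k ⊗ₜ D.L k := D.comulHom_X k
  have h' : HopfAlgebra.antipode ℂ (D.X k) = -(D.X k * D.Kpow (-D.u k)) := D.antipodeHom_X k
  have h'' : HopfAlgebra.antipode ℂ (D.L k) = D.Kpow (-D.u k) := D.antipodeHom_Kpow (D.u k)
  simp [HopfAlgebra.adjointAction, HopfAlgebra.rmulAntipode, HopfAlgebra.antipodeAlgHomOp,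
    -Bialgebra.comulAlgHom_apply, h, h', h'', mul_assoc, sub_mul]
  abel

/-! ## The modules `P_p`, `V_p^r`, `S_p`

A tuple `r ∈ {0,1}^t` is encoded as the subset `{k | r_k = 1}` of `Fin t`. -/

/-- `X^r = ∏_{k ∈ r} X_k`, in increasing order of the indices. -/
def Xpow (r : Finset (Fin t)) : D.H :=
  ((List.finRange t).map fun k => if k ∈ r then D.X k else 1).prod

/-- `L^{-r} = ∏_{k ∈ r} L_k⁻¹`. -/
def Linv (r : Finset (Fin t)) : D.H := D.Kpow (-∑ k ∈ r, D.u k)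

/-- The idempotent `φ^a_p = (1/m_a) ∑_{j=0}^{m_a-1} ξ_a^{-jp} K_a^j`. -/
def phi (a : Fin s) (p : ZMod (D.m a)) : D.H :=
  (1 / (D.m a : ℂ)) •
    ∑ j ∈ Finset.range (D.m a), (D.ξ a ^ (-((j : ℤ) * (p.val : ℤ)))) • D.K a ^ j

/-- The idempotent `ω_p = ∏ₐ φ^a_{p_a}`. -/
def omega (p : D.Z) : D.H := ((List.finRange s).map fun a => D.phi a (p a)).prod

/-- `P_p = H ω_p`, a submodule of the regular representation. -/
def P (p : D.Z) : Submodule D.H D.H := Submodule.span D.H {D.omega p}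

/-- `V_p^r = H X^r ω_p`, a submodule of `P_p`. -/
def V (r : Finset (Fin t)) (p : D.Z) : Submodule D.H D.H :=
  Submodule.span D.H {D.Xpow r * D.omega p}

/-- `S_p = V_p^{(1,…,1)}`. -/
def S (p : D.Z) : Submodule D.H D.H := D.V Finset.univ p

/-- The head `P_p / Rad P_p` of `P_p`. -/
abbrev Head (p : D.Z) : Type := ↥(D.P p) ⧸ Module.jacobson D.H ↥(D.P p)

/-! ## The data of the decomposition -/

open Classical in
/-- `r(w)`: the set of all `k` such that `X_k` commutes with `K^w`. -/
def rvec (w : D.Z) : Finset (Fin t) := Finset.univ.filter fun k => Commute (D.X k) (D.Kpow w)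

/-- `l(c) = ∑_{k ∈ c} d_k`, so that `K_a X^c = ξ_a^{l(c)_a} X^c K_a`. The family `ℒ_r`
("with multiplicities") is the family `l(c)` indexed by all `c ⊆ r`; `ℒ` is the case of full `r`. -/
def ell (c : Finset (Fin t)) : D.Z := ∑ k ∈ c, D.d k

/-- The contribution of the grouplike `K^w`: the submodule of `(H, ▷)` generated by the monomials
`X^a L^{-a} K^w`. -/
def contribution (w : D.Z) : Submodule D.H (AdjointRep ℂ D.H) :=
  Submodule.span D.H
    (Set.range fun a : Finset (Fin t) => AdjointRep.of ℂ D.H (D.Xpow a * D.Linv a * D.Kpow w))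

end NenciuDatum

end

/-!
The monomials `E(a, w) = X^a L^{-a} K^w` form a basis of `H`, and the adjoint action on them is
monomial: `K^v ▷ E(a, w) = ξ^{v · l(a)} E(a, w)`, while `X_k ▷ E(a, w)` is a nonzero multiple of
`E(a ∪ {k}, w)` if `k ∉ a` and `K^w` does not commute with `X_k`, and zero otherwise
(`X_smul_adjMonomial`). So the exponent `w` and the set `a ∩ r(w)` never change, and `(H, ▷)` splits
into the cyclic submodules generated by the `E(c, w)` with `c ⊆ r(w)`. That the `E(a, w)` are
linearly independent is seen in an explicit representation of `H` on functions
`Finset (Fin t) → B`, with `B` the group algebra of `ℤ_m` (`linearIndependent_Xpow_mul_Kpow`);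
with `B = ℂ` the same representation shows that the `X^a ω_p` are linearly independent.

The summands are identified through a common description of their generators. If `n` is a weight
vector of weight `μ`, killed by the `X_k` with `k ∈ r`, such that the `X^b n` with `b` disjoint from
`r` are linearly independent (`IsGen r μ n`), then the annihilator of `n` is the left ideal
generated by the `K^v - ξ^{v · μ}` and the `X_k`, `k ∈ r`. Hence `H n` depends only on `r` and `μ`
(`IsGen.nonempty_equiv`). Both `E(r(w) \ c, w)` and the generator `X^{r(w)} ω_{-l(c)}` of
`V^{r(w)}_{-l(c)}` are of this kind, with `r = r(w)` and `μ = l(r(w)) - l(c)`. For full `r` the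
module `H n` is one-dimensional, and the head of `P_p` is of this kind with weight `p`, since the
radical of `P_p` contains all `X_k ω_p` but not `ω_p`.

Every nonzero submodule of such a module `H n` contains `X^{rᶜ} n ≠ 0`
(`IsGen.Xpow_compl_smul_mem`), so two of them always meet and `H n` is indecomposable.
-/

noncomputable section

namespace NenciuDatum

variable {s t : ℕ} (D : NenciuDatum s t)

/-! ### Products of the generators -/

theorem xi_ne_zero (x : D.Z) : D.xi x ≠ 0 := by
  intro h
  have := D.xi_neg_mul x
  simp [h] at this

theorem K_pow_mod (a : Fin s) (n : ℕ) : D.K a ^ (n % D.m a) = D.K a ^ n :=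
  (pow_eq_pow_mod n (D.K_pow a)).symm

theorem Kpow_single (a : Fin s) : D.Kpow (Pi.single a 1) = D.K a := by
  have h : ∀ b ∈ List.finRange s, b ≠ a →
      D.K b ^ ((Pi.single a 1 : D.Z) b).val = 1 := by
    intro b _ hb
    simp [Pi.single_eq_of_ne hb]
  have h1 : D.K a ^ ((1 : ZMod (D.m a))).val = D.K a := by
    rw [ZMod.val_one_eq_one_mod, K_pow_mod, pow_one]
  unfold Kpow
  rw [List.prod_map_eq_pow_single a _ (fun b hb h' => h b h' hb),
    List.count_eq_one_of_mem (List.nodup_finRange s) (List.mem_finRange a)]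
  simp [h1]

theorem xi_single_mul (a : Fin s) (x : D.Z) :
    D.xi (Pi.single a 1 * x) = D.ξ a ^ (x a).val := by
  unfold xi
  rw [Finset.prod_eq_single a]
  · simp
  · intro b _ hb
    simp [Pi.single_eq_of_ne hb]
  · simp

/-- A subspace of an `H`-module is a submodule if it is stable under the `K^v` and the `X_k`. -/
theorem mem_of_left_mul {M : Type*} [AddCommGroup M] [Module ℂ M] [Module D.H M]
    [IsScalarTower ℂ D.H M] (N : Submodule ℂ M) (hK : ∀ v, ∀ x ∈ N, D.Kpow v • x ∈ N)
    (hX : ∀ k, ∀ x ∈ N, D.X k • x ∈ N) (h : D.H) : ∀ x ∈ N, h • x ∈ N := by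
  induction h using D.gen_induction with
  | hK a => rw [← D.Kpow_single a]; exact hK _
  | hX k => exact hX k
  | hc c =>
    intro x hx
    rw [algebraMap_smul]
    exact N.smul_mem c hx
  | hadd x y hx hy => intro z hz; rw [add_smul]; exact N.add_mem (hx z hz) (hy z hz)
  | hmul x y hx hy => intro z hz; rw [mul_smul]; exact hx _ (hy z hz)

theorem Xpow_empty : D.Xpow ∅ = 1 := by simp [Xpow]

/-- The scalar collects the factors from moving `X_k` past the `X_l`, `l ∈ a`, `l < k`; only its
being nonzero matters. -/
theorem X_mul_Xpow {k : Fin t} {a : Finset (Fin t)} (hk : k ∉ a) :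
    ∃ c : ℂ, c ≠ 0 ∧ D.X k * D.Xpow a = c • D.Xpow (insert k a) := by
  have key : ∀ l : List (Fin t), l.Nodup → k ∈ l → ∃ c : ℂ, c ≠ 0 ∧
      D.X k * (l.map fun j => if j ∈ a then D.X j else 1).prod =
        c • (l.map fun j => if j ∈ insert k a then D.X j else 1).prod := by
    intro l hl hkl
    induction l with
    | nil => simp at hkl
    | cons j l ih =>
      rw [List.nodup_cons] at hl
      by_cases hjk : j = k
      · subst hjk
        refine ⟨1, one_ne_zero, ?_⟩
        have : (l.map fun i => if i ∈ insert j a then D.X i else 1) =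
            l.map fun i => if i ∈ a then D.X i else 1 := by
          refine List.map_congr_left fun i hi => ?_
          have : i ≠ j := fun h => hl.1 (h ▸ hi)
          simp [this]
        rw [List.map_cons, List.map_cons, this]
        simp [hk]
      · have hkl' : k ∈ l := by
          rcases List.mem_cons.1 hkl with h | h
          · exact absurd h.symm hjk
          · exact h
        obtain ⟨c, hc, e⟩ := ih hl.2 hkl'
        by_cases hja : j ∈ a
        · refine ⟨D.xi (D.u k * D.d j) * c, mul_ne_zero (D.xi_ne_zero _) hc, ?_⟩
          simp only [List.map_cons, List.prod_cons, hja, if_true, Finset.mem_insert_of_mem hja]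
          rw [← mul_assoc, D.X_X k j (Ne.symm hjk), smul_mul_assoc, mul_assoc, e, mul_smul_comm,
            smul_smul]
        · refine ⟨c, hc, ?_⟩
          have : j ∉ insert k a := by simp [hjk, hja]
          simp only [List.map_cons, List.prod_cons, hja, if_false, this, one_mul, e]
  exact key _ (List.nodup_finRange t) (List.mem_finRange k)

theorem Xpow_insert {k : Fin t} {a : Finset (Fin t)} (hk : k ∉ a) :
    ∃ c : ℂ, c ≠ 0 ∧ D.Xpow (insert k a) = c • (D.X k * D.Xpow a) := by
  obtain ⟨c, hc, e⟩ := D.X_mul_Xpow hk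
  exact ⟨c⁻¹, inv_ne_zero hc, by rw [e, smul_smul, inv_mul_cancel₀ hc, one_smul]⟩

theorem Xpow_singleton (k : Fin t) : ∃ c : ℂ, c ≠ 0 ∧ D.X k = c • D.Xpow {k} := by
  simpa [Xpow_empty] using D.X_mul_Xpow (Finset.notMem_empty k)

theorem X_mul_Xpow_of_mem {k : Fin t} {a : Finset (Fin t)} (hk : k ∈ a) :
    D.X k * D.Xpow a = 0 := by
  obtain ⟨c, -, e⟩ := D.Xpow_insert (Finset.notMem_erase k a)
  rw [Finset.insert_erase hk] at e
  rw [e, mul_smul_comm, ← mul_assoc, X_sq, zero_mul, smul_zero]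

theorem Xpow_mul_Xpow {a b : Finset (Fin t)} (h : Disjoint a b) :
    ∃ c : ℂ, c ≠ 0 ∧ D.Xpow a * D.Xpow b = c • D.Xpow (a ∪ b) := by
  induction a using Finset.induction_on with
  | empty => exact ⟨1, one_ne_zero, by simp [Xpow_empty]⟩
  | insert k a hk ih =>
    rw [Finset.disjoint_insert_left] at h
    obtain ⟨c, hc, e⟩ := ih h.2
    obtain ⟨c', hc', e'⟩ := D.Xpow_insert hk
    obtain ⟨c₂, hc₂, e₂⟩ := D.X_mul_Xpow (k := k) (a := a ∪ b) (by simp [hk, h.1])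
    refine ⟨c' * c * c₂, by simp [*], ?_⟩
    rw [e', smul_mul_assoc, mul_assoc, e, mul_smul_comm, e₂, smul_smul, smul_smul,
      Finset.insert_union]

theorem Xpow_mul_Xpow_of_not_disjoint {a b : Finset (Fin t)} (h : ¬ Disjoint a b) :
    D.Xpow a * D.Xpow b = 0 := by
  induction a using Finset.induction_on with
  | empty => simp at h
  | insert k a hk ih =>
    obtain ⟨c', hc', e'⟩ := D.Xpow_insert hk
    rw [e', smul_mul_assoc, mul_assoc]
    by_cases hab : Disjoint a b
    · have hkb : k ∈ b := by
        by_contra hkb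
        exact h (Finset.disjoint_insert_left.2 ⟨hkb, hab⟩)
      obtain ⟨c, -, e⟩ := D.Xpow_mul_Xpow hab
      rw [e, mul_smul_comm, D.X_mul_Xpow_of_mem (Finset.mem_union_right a hkb), smul_zero,
        smul_zero]
    · rw [ih hab, mul_zero, smul_zero]

theorem Xpow_mul_X_of_mem {k : Fin t} {a : Finset (Fin t)} (hk : k ∈ a) :
    D.Xpow a * D.X k = 0 := by
  obtain ⟨c, -, e⟩ := D.Xpow_singleton k
  rw [e, mul_smul_comm, D.Xpow_mul_Xpow_of_not_disjoint (by simpa using hk), smul_zero]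

theorem Xpow_mul_X (k : Fin t) (a : Finset (Fin t)) :
    D.Xpow a * D.X k = D.xi ((∑ l ∈ a, D.u l) * D.d k) • (D.X k * D.Xpow a) := by
  by_cases hk : k ∈ a
  · rw [D.Xpow_mul_X_of_mem hk, D.X_mul_Xpow_of_mem hk, smul_zero]
  induction a using Finset.induction_on with
  | empty => simp [Xpow_empty, xi_zero]
  | insert j a hj ih =>
    rw [Finset.mem_insert, not_or] at hk
    obtain ⟨c, hc, e⟩ := D.Xpow_insert hj
    rw [e, smul_mul_assoc, mul_assoc, ih hk.2, mul_smul_comm, ← mul_assoc,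
      D.X_X j k (Ne.symm hk.1), Finset.sum_insert hj, add_mul, xi_add, mul_smul_comm,
      smul_mul_assoc, mul_assoc, smul_smul, smul_smul, smul_smul]
    congr 1; ring

theorem Kpow_mul_Xpow (v : D.Z) (a : Finset (Fin t)) :
    D.Kpow v * D.Xpow a = D.xi (v * D.ell a) • (D.Xpow a * D.Kpow v) := by
  induction a using Finset.induction_on with
  | empty => simp [Xpow_empty, xi_zero, ell]
  | insert j a hj ih =>
    obtain ⟨c, hc, e⟩ := D.Xpow_insert hj
    have : D.ell (insert j a) = D.d j + D.ell a := Finset.sum_insert hj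
    rw [e, mul_smul_comm, ← mul_assoc, Kpow_X, smul_mul_assoc, mul_assoc, ih, this, mul_add,
      xi_add, mul_smul_comm, smul_mul_assoc, mul_assoc, smul_smul, smul_smul, smul_smul]
    congr 1; ring

/-! ### Weight vectors and the idempotents `ω_p` -/

section Weight

variable {D} {M : Type*} [AddCommGroup M] [Module ℂ M] [Module D.H M]

/-- `n` is a weight vector of weight `μ`: every `K^v` acts on it by the scalar `ξ^{v · μ}`. -/
def IsWeight (μ : D.Z) (n : M) : Prop := ∀ v : D.Z, D.Kpow v • n = D.xi (v * μ) • n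

theorem IsWeight.K_smul {μ : D.Z} {n : M} (h : IsWeight μ n) (a : Fin s) :
    D.K a • n = D.ξ a ^ (μ a).val • n := by
  rw [← D.Kpow_single a, h, xi_single_mul]

variable [IsScalarTower ℂ D.H M]

theorem isWeight_of_K {μ : D.Z} {n : M} (h : ∀ a, D.K a • n = D.ξ a ^ (μ a).val • n) :
    IsWeight μ n := by
  intro v
  have hp : ∀ a (j : ℕ), D.K a ^ j • n = D.ξ a ^ (j * (μ a).val) • n := by
    intro a j
    induction j with
    | zero => simp
    | succ j ih =>
      rw [pow_succ, mul_smul, h, smul_algebra_smul_comm, ih, smul_smul, ← pow_add]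
      congr 2; ring
  have key : ∀ l : List (Fin s), (l.map fun a => D.K a ^ (v a).val).prod • n =
      (l.map fun a => D.ξ a ^ ((v * μ) a).val).prod • n := by
    intro l
    induction l with
    | nil => simp
    | cons a l ih =>
      rw [List.map_cons, List.prod_cons, mul_smul, ih, smul_algebra_smul_comm, hp, smul_smul,
        List.map_cons, List.prod_cons, Pi.mul_apply, ZMod.val_mul, root_pow_mod, mul_comm]
  have := key (List.finRange s)
  rwa [← Fin.prod_univ_def] at this

theorem IsWeight.Xpow_smul {μ : D.Z} {n : M} (h : IsWeight μ n) (a : Finset (Fin t)) :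
    IsWeight (D.ell a + μ) (D.Xpow a • n) := by
  intro v
  rw [smul_smul, Kpow_mul_Xpow, smul_assoc, mul_smul, h, smul_algebra_smul_comm, smul_smul,
    mul_add, xi_add]

theorem phi_smul (a : Fin s) (p : ZMod (D.m a)) {n : M} (h : D.K a • n = D.ξ a ^ p.val • n) :
    D.phi a p • n = n := by
  have hp : ∀ j : ℕ, D.K a ^ j • n = D.ξ a ^ (j * p.val) • n := by
    intro j
    induction j with
    | zero => simp
    | succ j ih =>
      rw [pow_succ, mul_smul, h, smul_algebra_smul_comm, ih, smul_smul, ← pow_add]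
      congr 2; ring
  have hξ : D.ξ a ≠ 0 := (D.ξ_prim a).ne_zero (D.m_pos a).ne'
  have hm : (D.m a : ℂ) ≠ 0 := Nat.cast_ne_zero.2 (D.m_pos a).ne'
  have : ∀ j : ℕ, (D.ξ a ^ (-((j : ℤ) * (p.val : ℤ)))) • D.K a ^ j • n = n := by
    intro j
    rw [hp, smul_smul, ← zpow_natCast, ← zpow_add₀ hξ]
    simp
  rw [phi, smul_assoc, Finset.sum_smul]
  simp only [smul_assoc, this]
  rw [Finset.sum_const, Finset.card_range, ← Nat.cast_smul_eq_nsmul ℂ, smul_smul,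
    one_div_mul_cancel hm, one_smul]

theorem IsWeight.omega_smul {p : D.Z} {n : M} (h : IsWeight p n) : D.omega p • n = n := by
  have key : ∀ l : List (Fin s), (l.map fun a => D.phi a (p a)).prod • n = n := by
    intro l
    induction l with
    | nil => simp
    | cons a l ih =>
      rw [List.map_cons, List.prod_cons, mul_smul, ih, phi_smul a _ (h.K_smul a)]
  exact key _

end Weight

theorem K_mul_phi (a : Fin s) (p : ZMod (D.m a)) :
    D.K a * D.phi a p = D.ξ a ^ p.val • D.phi a p := by
  have hξ : D.ξ a ≠ 0 := (D.ξ_prim a).ne_zero (D.m_pos a).ne'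
  set f : ℕ → D.H := fun j => (D.ξ a ^ (-((j : ℤ) * (p.val : ℤ)))) • D.K a ^ j with hf
  have hstep : ∀ j, D.K a * f j = D.ξ a ^ p.val • f (j + 1) := by
    intro j
    simp only [hf]
    rw [mul_smul_comm, ← pow_succ', smul_smul, ← zpow_natCast, ← zpow_add₀ hξ]
    congr 2
    push_cast; ring
  have hper : f (D.m a) = f 0 := by
    have h1 : D.ξ a ^ (-((D.m a : ℤ) * (p.val : ℤ))) = 1 := by
      rw [zpow_neg, zpow_mul, zpow_natCast (D.ξ a) (D.m a), (D.ξ_prim a).pow_eq_one,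
        one_zpow, inv_one]
    simp only [hf, h1, K_pow]
    simp
  have hsum : ∑ j ∈ Finset.range (D.m a), f (j + 1) = ∑ j ∈ Finset.range (D.m a), f j := by
    have := (Finset.sum_range_succ f (D.m a)).symm.trans (Finset.sum_range_succ' f (D.m a))
    rw [hper] at this
    exact (add_right_cancel this).symm
  change D.K a * ((1 / (D.m a : ℂ)) • ∑ j ∈ Finset.range (D.m a), f j) =
    D.ξ a ^ p.val • ((1 / (D.m a : ℂ)) • ∑ j ∈ Finset.range (D.m a), f j)
  rw [mul_smul_comm, Finset.mul_sum, smul_comm]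
  simp only [hstep]
  rw [← Finset.smul_sum, hsum]

theorem K_commute_phi (a b : Fin s) (p : ZMod (D.m b)) : Commute (D.K a) (D.phi b p) :=
  ((Commute.sum_right _ _ _ fun j _ =>
    ((D.K_commute a b).pow_right j).smul_right _)).smul_right _

theorem omega_isWeight (p : D.Z) : IsWeight p (D.omega p) := by
  refine isWeight_of_K fun a => ?_
  have key : ∀ l : List (Fin s), a ∈ l → D.K a * (l.map fun b => D.phi b (p b)).prod =
      D.ξ a ^ (p a).val • (l.map fun b => D.phi b (p b)).prod := by
    intro l hl
    induction l with
    | nil => simp at hl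
    | cons b l ih =>
      rw [List.map_cons, List.prod_cons]
      by_cases hab : a = b
      · subst hab
        rw [← mul_assoc, K_mul_phi, smul_mul_assoc]
      · have : a ∈ l := by simpa [hab] using hl
        rw [← mul_assoc, (D.K_commute_phi a b _).eq, mul_assoc, ih this, mul_smul_comm]
  exact key _ (List.mem_finRange a)

theorem omega_mul_self (p : D.Z) : D.omega p * D.omega p = D.omega p :=
  (D.omega_isWeight p).omega_smul

/-! ### Linear independence of monomials -/

/-- The factor `∏_{l ∈ a, l < k} ξ^{u_k · d_l}` picked up when `X_k` is moved to its place in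
`X^a`. -/
def sortCoeff (k : Fin t) (a : Finset (Fin t)) : ℂ :=
  ∏ l ∈ a with l < k, D.xi (D.u k * D.d l)

theorem sortCoeff_ne_zero (k : Fin t) (a : Finset (Fin t)) : D.sortCoeff k a ≠ 0 :=
  Finset.prod_ne_zero_iff.2 fun _ _ => D.xi_ne_zero _

theorem sortCoeff_insert (k : Fin t) {l : Fin t} {a : Finset (Fin t)} (hl : l ∉ a) :
    D.sortCoeff k (insert l a) =
      (if l < k then D.xi (D.u k * D.d l) else 1) * D.sortCoeff k a := by
  unfold sortCoeff
  rw [Finset.filter_insert]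
  split_ifs with h
  · rw [Finset.prod_insert (by simp [hl])]
  · rw [one_mul]

theorem sortCoeff_comm {k l : Fin t} (h : k ≠ l) {a : Finset (Fin t)} (hk : k ∉ a) (hl : l ∉ a) :
    D.sortCoeff k (insert l a) * D.sortCoeff l a =
      D.xi (D.u k * D.d l) * (D.sortCoeff l (insert k a) * D.sortCoeff k a) := by
  rw [D.sortCoeff_insert k hl, D.sortCoeff_insert l hk]
  rcases lt_or_gt_of_ne h with h' | h'
  · rw [if_neg h'.not_gt, if_pos h']
    linear_combination (-(D.sortCoeff k a * D.sortCoeff l a)) * D.xi_pair k l h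
  · rw [if_pos h', if_neg h'.not_gt]
    ring

section Rep

variable {B : Type*} [CommRing B] [Algebra ℂ B]

/-- The operator by which `K_a` acts on functions `Finset (Fin t) → B`, the indicator of `c`
standing for `X^c`. -/
def repK (κ : Fin s → B) (a : Fin s) : Module.End ℂ (Finset (Fin t) → B) where
  toFun f c := D.ξ a ^ (D.ell c a).val • (κ a * f c)
  map_add' f g := by ext c; simp [mul_add]
  map_smul' z f := by ext c; simp [smul_comm z]

variable (B) in
/-- The operator by which `X_k` acts on functions `Finset (Fin t) → B`. -/
def repX (k : Fin t) : Module.End ℂ (Finset (Fin t) → B) where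
  toFun f c := if k ∈ c then D.sortCoeff k (c.erase k) • f (c.erase k) else 0
  map_add' f g := by ext c; by_cases h : k ∈ c <;> simp [h]
  map_smul' z f := by ext c; by_cases h : k ∈ c <;> simp [h, smul_comm z]

theorem repK_apply (κ : Fin s → B) (a : Fin s) (f : Finset (Fin t) → B) (c : Finset (Fin t)) :
    D.repK κ a f c = D.ξ a ^ (D.ell c a).val • (κ a * f c) := rfl

theorem repX_apply (k : Fin t) (f : Finset (Fin t) → B) (c : Finset (Fin t)) :
    D.repX B k f c = if k ∈ c then D.sortCoeff k (c.erase k) • f (c.erase k) else 0 := rfl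

theorem repK_pow_apply (κ : Fin s → B) (a : Fin s) (n : ℕ) (f : Finset (Fin t) → B)
    (c : Finset (Fin t)) :
    (D.repK κ a ^ n) f c = D.ξ a ^ (n * (D.ell c a).val) • (κ a ^ n * f c) := by
  induction n with
  | zero => simp
  | succ n ih =>
    rw [pow_succ', Module.End.mul_apply, repK_apply, ih, mul_smul_comm, smul_smul,
      ← mul_assoc, ← pow_succ', ← pow_add]
    congr 2; ring

theorem rep_relations {κ : Fin s → B} (hκ : ∀ a, κ a ^ D.m a = 1) :
    D.Relations (D.repK κ) (D.repX B) where
  K_pow a := by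
    refine LinearMap.ext fun f => funext fun c => ?_
    rw [repK_pow_apply, hκ, pow_mul, (D.ξ_prim a).pow_eq_one]
    simp
  K_comm a b := by
    refine LinearMap.ext fun f => funext fun c => ?_
    simp only [Module.End.mul_apply, repK_apply, mul_smul_comm]
    rw [smul_comm, mul_left_comm]
  X_sq k := by
    refine LinearMap.ext fun f => funext fun c => ?_
    simp [repX_apply]
  K_X a k := by
    refine LinearMap.ext fun f => funext fun c => ?_
    by_cases h : k ∈ c
    · have h1 : D.ell c = D.d k + D.ell (c.erase k) := (Finset.add_sum_erase c _ h).symm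
      have h2 : D.ξ a ^ (D.ell c a).val =
          D.ξ a ^ (D.d k a).val * D.ξ a ^ (D.ell (c.erase k) a).val := by
        rw [h1, Pi.add_apply, ZMod.val_add, root_pow_mod, pow_add]
      simp only [Module.End.mul_apply, LinearMap.smul_apply, Pi.smul_apply, repK_apply,
        repX_apply, h, if_true, h2, mul_smul_comm, smul_smul]
      congr 1; ring
    · simp [repX_apply, repK_apply, h]
  X_X k l h := by
    refine LinearMap.ext fun f => funext fun c => ?_
    by_cases hk : k ∈ c
    · by_cases hl : l ∈ c
      · have e := D.sortCoeff_comm h (a := (c.erase k).erase l) (by simp) (by simp)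
        rw [Finset.insert_erase (by simp [hl, h.symm]), Finset.erase_right_comm,
          Finset.insert_erase (by simp [hk, h])] at e
        simp only [Module.End.mul_apply, LinearMap.smul_apply, Pi.smul_apply, repX_apply, hk, hl,
          Finset.mem_erase, ne_eq, h, h.symm, not_false_eq_true, and_self, if_true, smul_smul,
          Finset.erase_right_comm (a := k) (b := l), e]
      · simp [repX_apply, hl]
    · simp [repX_apply, hk]

/-- `H` acts on functions `Finset (Fin t) → B`, for every commutative algebra `B` with elements
`κ_a` such that `κ_a ^ m_a = 1`. -/
def rep {κ : Fin s → B} (hκ : ∀ a, κ a ^ D.m a = 1) :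
    D.H →ₐ[ℂ] Module.End ℂ (Finset (Fin t) → B) :=
  D.lift (D.rep_relations hκ)

theorem rep_X_single {κ : Fin s → B} (hκ : ∀ a, κ a ^ D.m a = 1) {k : Fin t}
    {a : Finset (Fin t)} (hk : k ∉ a) (x : B) :
    D.rep hκ (D.X k) (Pi.single a x) = D.sortCoeff k a • Pi.single (insert k a) x := by
  rw [rep, lift_X]
  ext c
  by_cases hc : c = insert k a
  · subst hc
    simp [repX, hk]
  · by_cases hkc : k ∈ c
    · have : c.erase k ≠ a := by
        rintro rfl
        exact hc (Finset.insert_erase hkc).symm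
      simp [repX, hkc, hc, this]
    · simp [repX, hkc, hc]

theorem rep_Xpow_single {κ : Fin s → B} (hκ : ∀ a, κ a ^ D.m a = 1) (a : Finset (Fin t)) :
    ∃ c : ℂ, c ≠ 0 ∧ ∀ x : B, D.rep hκ (D.Xpow a) (Pi.single ∅ x) = c • Pi.single a x := by
  induction a using Finset.induction_on with
  | empty => exact ⟨1, one_ne_zero, by simp [Xpow_empty]⟩
  | insert k a hk ih =>
    obtain ⟨c, hc, e⟩ := ih
    obtain ⟨c', hc', e'⟩ := D.Xpow_insert hk
    refine ⟨c' * c * D.sortCoeff k a, by simp [hc, hc', sortCoeff_ne_zero], fun x => ?_⟩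
    rw [e', map_smul, map_mul, LinearMap.smul_apply, Module.End.mul_apply, e, map_smul,
      rep_X_single D hκ hk, smul_smul, smul_smul, mul_assoc]

theorem rep_K_pow_single {κ : Fin s → B} (hκ : ∀ a, κ a ^ D.m a = 1) (a : Fin s) (n : ℕ) (x : B) :
    D.rep hκ (D.K a ^ n) (Pi.single ∅ x) = Pi.single ∅ (κ a ^ n * x) := by
  rw [map_pow, rep, lift_K]
  ext c
  rw [repK_pow_apply]
  by_cases hc : c = ∅
  · subst hc; simp [ell]
  · simp [hc]

theorem rep_Kpow_single {κ : Fin s → B} (hκ : ∀ a, κ a ^ D.m a = 1) (v : D.Z) (x : B) :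
    D.rep hκ (D.Kpow v) (Pi.single ∅ x) = Pi.single ∅ ((∏ a, κ a ^ (v a).val) * x) := by
  have key : ∀ l : List (Fin s),
      D.rep hκ (l.map fun a => D.K a ^ (v a).val).prod (Pi.single ∅ x) =
        Pi.single ∅ ((l.map fun a => κ a ^ (v a).val).prod * x) := by
    intro l
    induction l with
    | nil => simp
    | cons a l ih =>
      rw [List.map_cons, List.prod_cons, map_mul, Module.End.mul_apply, ih, rep_K_pow_single,
        List.map_cons,
        List.prod_cons, mul_assoc]
  have := key (List.finRange s)
  rwa [← Fin.prod_univ_def] at this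

end Rep

/-- The monomials `X^a ω_p` are linearly independent: in the representation with `κ_a = ξ_a^{p_a}`
they map the vacuum vector to multiples of distinct basis vectors. -/
theorem linearIndependent_Xpow_mul_omega (p : D.Z) :
    LinearIndependent ℂ fun a => D.Xpow a * D.omega p := by
  have hκ : ∀ a, (D.ξ a ^ (p a).val) ^ D.m a = 1 := fun a => by
    rw [← pow_mul, mul_comm, pow_mul, (D.ξ_prim a).pow_eq_one, one_pow]
  let _ : Module D.H (Finset (Fin t) → ℂ) := Module.compHom _ (D.rep hκ).toRingHom
  have hsmul : ∀ (h : D.H) (f : Finset (Fin t) → ℂ), h • f = D.rep hκ h f := fun _ _ => rfl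
  have _ : IsScalarTower ℂ D.H (Finset (Fin t) → ℂ) := ⟨fun z h f => by
    rw [hsmul, hsmul, map_smul, LinearMap.smul_apply]⟩
  have hω : D.omega p • (Pi.single ∅ 1 : Finset (Fin t) → ℂ) = Pi.single ∅ 1 := by
    refine IsWeight.omega_smul (isWeight_of_K fun a => ?_)
    have h := D.rep_K_pow_single hκ a 1 1
    rw [pow_one, pow_one] at h
    rw [hsmul, h, ← Pi.single_smul, smul_eq_mul]
  choose c hc e using D.rep_Xpow_single hκ
  refine LinearIndependent.of_comp ((D.rep hκ).toLinearMap.flip (Pi.single ∅ 1)) ?_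
  have : ((D.rep hκ).toLinearMap.flip (Pi.single ∅ 1)) ∘ (fun a => D.Xpow a * D.omega p) =
      (fun a => Units.mk0 (c a) (hc a)) • (Pi.basisFun ℂ (Finset (Fin t))) := by
    funext a
    change D.rep hκ (D.Xpow a * D.omega p) (Pi.single ∅ 1) = _
    rw [map_mul, Module.End.mul_apply, ← hsmul (D.omega p), hω, e]
    simp [Units.smul_def]
  rw [this]
  exact (Pi.basisFun ℂ _).linearIndependent.units_smul _

/-- The monomials `X^a K^v` are linearly independent: let `H` act on functions with values in the
group algebra of `ℤ_m`. -/
theorem linearIndependent_Xpow_mul_Kpow :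
    LinearIndependent ℂ fun x : Finset (Fin t) × D.Z => D.Xpow x.1 * D.Kpow x.2 := by
  let κ : Fin s → AddMonoidAlgebra ℂ D.Z := fun a => AddMonoidAlgebra.single (Pi.single a 1) 1
  have hκ : ∀ a, κ a ^ D.m a = 1 := fun a => by
    simp only [κ, AddMonoidAlgebra.single_pow, one_pow]
    rw [← Pi.single_smul]
    simp [AddMonoidAlgebra.one_def]
  have hprod : ∀ v : D.Z, ∏ a, κ a ^ (v a).val = AddMonoidAlgebra.single v 1 := by
    intro v
    have : ∀ F : Finset (Fin s), ∏ a ∈ F, κ a ^ (v a).val =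
        AddMonoidAlgebra.single (∑ a ∈ F, Pi.single a (v a)) 1 := by
      intro F
      induction F using Finset.induction_on with
      | empty => simp [AddMonoidAlgebra.one_def]
      | insert a F ha ih =>
        rw [Finset.prod_insert ha, ih, Finset.sum_insert ha]
        simp only [κ, AddMonoidAlgebra.single_pow, one_pow, AddMonoidAlgebra.single_mul_single,
          one_mul]
        rw [← Pi.single_smul]
        simp
    rw [this, Finset.univ_sum_single]
  choose c hc e using D.rep_Xpow_single hκ
  rw [Fintype.linearIndependent_iff]
  intro g hg ⟨a, v⟩
  have h1 := congrArg (fun h => D.rep hκ h (Pi.single ∅ 1)) hg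
  simp only [map_sum, map_smul, map_mul, LinearMap.sum_apply, LinearMap.smul_apply,
    Module.End.mul_apply, rep_Kpow_single, hprod, e, map_zero, LinearMap.zero_apply, mul_one] at h1
  have h2 := congrArg (fun f => (f a).coeff v) h1
  simpa [Finset.sum_apply, Fintype.sum_prod_type, Pi.single_apply, Finsupp.single_apply, hc]
    using h2

end NenciuDatum

end


noncomputable section

namespace NenciuDatum

variable {s t : ℕ} {D : NenciuDatum s t}

/-! ### Cyclic modules generated by a weight vector -/

section Cyclic

variable {M : Type*} [AddCommGroup M] [Module ℂ M] [Module D.H M]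

/-- `n` is a weight vector of weight `μ`, killed by the `X_k` with `k ∈ r`, and the vectors
`X^b n` with `b` disjoint from `r` are linearly independent. -/
structure IsGen (r : Finset (Fin t)) (μ : D.Z) (n : M) : Prop where
  weight : IsWeight μ n
  kill : ∀ k ∈ r, D.X k • n = 0
  indep : LinearIndependent ℂ fun b : {b : Finset (Fin t) // Disjoint b r} => D.Xpow b.1 • n

theorem IsGen.ne_zero {r : Finset (Fin t)} {μ : D.Z} {n : M} (hn : IsGen r μ n) : n ≠ 0 := by
  have := hn.indep.ne_zero ⟨∅, Finset.disjoint_empty_left r⟩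
  simpa [Xpow_empty] using this

theorem isGen_univ {μ : D.Z} {n : M} (hw : IsWeight μ n) (hk : ∀ k, D.X k • n = 0) (h0 : n ≠ 0) :
    IsGen Finset.univ μ n where
  weight := hw
  kill k _ := hk k
  indep := by
    have : Subsingleton {b : Finset (Fin t) // Disjoint b Finset.univ} :=
      ⟨fun a b => Subtype.ext ((disjoint_top.1 a.2).trans (disjoint_top.1 b.2).symm)⟩
    rw [linearIndependent_subsingleton_index_iff]
    rintro ⟨b, hb⟩
    have : b = ∅ := disjoint_top.1 hb
    simpa [this, Xpow_empty] using h0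

variable (D) in
/-- The left ideal generated by the `K^v - ξ^{v · μ}` and the `X_k` with `k ∈ r`. -/
def weightIdeal (r : Finset (Fin t)) (μ : D.Z) : Submodule D.H D.H :=
  Submodule.span D.H (Set.range (fun v => D.Kpow v - algebraMap ℂ D.H (D.xi (v * μ))) ∪ D.X '' r)

/-- Modulo the left ideal, `H` is spanned by the `X^b` with `b` disjoint from `r`. -/
theorem exists_sub_mem_weightIdeal (r : Finset (Fin t)) (μ : D.Z) (h : D.H) :
    ∃ f : {b : Finset (Fin t) // Disjoint b r} → ℂ,
      h - ∑ b, f b • D.Xpow b.1 ∈ D.weightIdeal r μ := by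
  set J := D.weightIdeal r μ with hJ
  set E := Submodule.span ℂ
    (Set.range fun b : {b : Finset (Fin t) // Disjoint b r} => D.Xpow b.1) with hE
  set N := E ⊔ J.restrictScalars ℂ with hN
  have hEN : ∀ x ∈ E, x ∈ N := fun x hx => Submodule.mem_sup_left hx
  have hJN : ∀ x ∈ J, x ∈ N := fun x hx => Submodule.mem_sup_right (T := J.restrictScalars ℂ) hx
  have hmem : ∀ b : Finset (Fin t), Disjoint b r → D.Xpow b ∈ E := fun b hb =>
    Submodule.subset_span ⟨⟨b, hb⟩, rfl⟩
  have hstep : ∀ g : D.H, (∀ b : Finset (Fin t), Disjoint b r → g * D.Xpow b ∈ N) →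
      ∀ x ∈ N, g • x ∈ N := by
    intro g hg x hx
    obtain ⟨y, hy, z, hz, rfl⟩ := Submodule.mem_sup.1 hx
    rw [smul_add]
    refine N.add_mem ?_ (hJN _ (J.smul_mem g hz))
    have : E ≤ N.comap (LinearMap.mulLeft ℂ g) := by
      rw [hE, Submodule.span_le]
      rintro _ ⟨b, rfl⟩
      exact hg b.1 b.2
    exact this hy
  have hall : ∀ x ∈ N, h • x ∈ N := by
    refine D.mem_of_left_mul N (fun v => hstep _ fun b hb => ?_)
      (fun k => hstep _ fun b hb => ?_) h
    · have hv : D.Xpow b * (D.Kpow v - algebraMap ℂ D.H (D.xi (v * μ))) ∈ J :=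
        J.smul_mem _ (Submodule.subset_span (Or.inl ⟨v, rfl⟩))
      rw [Kpow_mul_Xpow]
      refine N.smul_mem _ ?_
      have := N.add_mem (hJN _ hv) (hEN _ (E.smul_mem (D.xi (v * μ)) (hmem b hb)))
      rwa [mul_sub, ← Algebra.commutes, ← Algebra.smul_def, sub_add_cancel] at this
    · by_cases hkr : k ∈ r
      · have hk : D.Xpow b * D.X k ∈ J :=
          J.smul_mem _ (Submodule.subset_span (Or.inr ⟨k, hkr, rfl⟩))
        rw [Xpow_mul_X] at hk
        have := N.smul_mem (D.xi ((∑ l ∈ b, D.u l) * D.d k))⁻¹ (hJN _ hk)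
        rwa [smul_smul, inv_mul_cancel₀ (D.xi_ne_zero _), one_smul] at this
      · by_cases hkb : k ∈ b
        · rw [D.X_mul_Xpow_of_mem hkb]; exact N.zero_mem
        · obtain ⟨c, -, e⟩ := D.X_mul_Xpow hkb
          rw [e]
          exact N.smul_mem _ (hEN _ (hmem _ (Finset.disjoint_insert_left.2 ⟨hkr, hb⟩)))
  have h1 : h ∈ N := by
    have := hall 1 (hEN _ (D.Xpow_empty ▸ hmem ∅ (Finset.disjoint_empty_left r)))
    simpa using this
  obtain ⟨y, hy, z, hz, rfl⟩ := Submodule.mem_sup.1 h1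
  obtain ⟨f, rfl⟩ := (Submodule.mem_span_range_iff_exists_fun ℂ).1 hy
  exact ⟨f, by simpa using hz⟩

variable [IsScalarTower ℂ D.H M]

theorem smul_eq_zero_of_mem_weightIdeal {r : Finset (Fin t)} {μ : D.Z} {n : M}
    (hw : IsWeight μ n) (hk : ∀ k ∈ r, D.X k • n = 0) {h : D.H} (hh : h ∈ D.weightIdeal r μ) :
    h • n = 0 := by
  have : D.weightIdeal r μ ≤ LinearMap.ker (LinearMap.toSpanSingleton D.H M n) := by
    rw [weightIdeal, Submodule.span_le]
    rintro _ (⟨v, rfl⟩ | ⟨k, hkr, rfl⟩)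
    · simp [sub_smul, hw v]
    · simpa using hk k hkr
  simpa using this hh

theorem exists_smul_eq_sum {r : Finset (Fin t)} {μ : D.Z} {n : M}
    (hw : IsWeight μ n) (hk : ∀ k ∈ r, D.X k • n = 0) (h : D.H) :
    ∃ f : {b : Finset (Fin t) // Disjoint b r} → ℂ,
      h - ∑ b, f b • D.Xpow b.1 ∈ D.weightIdeal r μ ∧ h • n = ∑ b, f b • D.Xpow b.1 • n := by
  obtain ⟨f, hf⟩ := exists_sub_mem_weightIdeal r μ h
  refine ⟨f, hf, ?_⟩
  have := smul_eq_zero_of_mem_weightIdeal hw hk hf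
  rw [sub_smul, Finset.sum_smul, sub_eq_zero] at this
  simpa only [smul_assoc] using this

theorem IsGen.span_restrictScalars {r : Finset (Fin t)} {μ : D.Z} {n : M} (hn : IsGen r μ n) :
    (Submodule.span D.H {n}).restrictScalars ℂ = Submodule.span ℂ
      (Set.range fun b : {b : Finset (Fin t) // Disjoint b r} => D.Xpow b.1 • n) := by
  refine le_antisymm (fun x hx => ?_) (Submodule.span_le.2 ?_)
  · obtain ⟨h, rfl⟩ := Submodule.mem_span_singleton.1 hx
    obtain ⟨f, -, e⟩ := exists_smul_eq_sum hn.weight hn.kill h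
    rw [e]
    exact (Submodule.mem_span_range_iff_exists_fun ℂ).2 ⟨f, rfl⟩
  · rintro _ ⟨b, rfl⟩
    exact Submodule.smul_mem _ _ (Submodule.mem_span_singleton_self n)

theorem IsGen.ker_toSpanSingleton {r : Finset (Fin t)} {μ : D.Z} {n : M} (hn : IsGen r μ n) :
    LinearMap.ker (LinearMap.toSpanSingleton D.H M n) = D.weightIdeal r μ := by
  refine le_antisymm (fun h hh => ?_) fun h hh => ?_
  · obtain ⟨f, hf, e⟩ := exists_smul_eq_sum hn.weight hn.kill h
    rw [LinearMap.mem_ker, LinearMap.toSpanSingleton_apply, e] at hh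
    have := Fintype.linearIndependent_iff.1 hn.indep f hh
    simpa [this] using hf
  · simpa using smul_eq_zero_of_mem_weightIdeal hn.weight hn.kill hh

/-- A cyclic module as above is determined by `r` and `μ`, because the annihilator of its generator
is. -/
theorem IsGen.nonempty_equiv {M' : Type*} [AddCommGroup M'] [Module ℂ M'] [Module D.H M']
    [IsScalarTower ℂ D.H M'] {r : Finset (Fin t)} {μ : D.Z} {n : M} {n' : M'}
    (hn : IsGen r μ n) (hn' : IsGen r μ n') :
    Nonempty (↥(Submodule.span D.H {n}) ≃ₗ[D.H] ↥(Submodule.span D.H {n'})) := by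
  refine ⟨?_ ≪≫ₗ (LinearMap.toSpanSingleton D.H M n).quotKerEquivRange.symm ≪≫ₗ
    Submodule.quotEquivOfEq _ _ (hn.ker_toSpanSingleton.trans hn'.ker_toSpanSingleton.symm) ≪≫ₗ
    (LinearMap.toSpanSingleton D.H M' n').quotKerEquivRange ≪≫ₗ ?_⟩
  · exact LinearEquiv.ofEq _ _ (LinearMap.span_singleton_eq_range D.H M n)
  · exact LinearEquiv.ofEq _ _ (LinearMap.span_singleton_eq_range D.H M' n').symm

/-- The submodule generated by `X^{rᶜ} n` is contained in every nonzero submodule of `H n`: if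
`b` is minimal among the exponents of a nonzero element, multiplication by `X^{rᶜ \ b}` kills all
its terms but the one with exponent `b`. -/
theorem IsGen.Xpow_compl_smul_mem {r : Finset (Fin t)} {μ : D.Z} {n : M} (hn : IsGen r μ n)
    {N : Submodule D.H M} (hN : N ≤ Submodule.span D.H {n}) (h0 : N ≠ ⊥) :
    D.Xpow rᶜ • n ∈ N := by
  obtain ⟨x, hxN, hx0⟩ := N.ne_bot_iff.1 h0
  obtain ⟨h, rfl⟩ := Submodule.mem_span_singleton.1 (hN hxN)
  obtain ⟨f, -, e⟩ := exists_smul_eq_sum hn.weight hn.kill h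
  have hne : (Finset.univ.filter fun b => f b ≠ 0).Nonempty := by
    by_contra hcon
    rw [Finset.not_nonempty_iff_eq_empty, Finset.filter_eq_empty_iff] at hcon
    refine hx0 (e.trans (Finset.sum_eq_zero fun b _ => ?_))
    rw [not_not.1 (hcon (Finset.mem_univ b)), zero_smul]
  obtain ⟨b, hb⟩ := Finset.exists_minimal hne
  have hfb : f b ≠ 0 := (Finset.mem_filter.1 hb.prop).2
  have hbr : b.1 ⊆ rᶜ := fun k hk => Finset.mem_compl.2 fun hkr =>
    Finset.disjoint_left.1 b.2 hk hkr
  have hmem := N.smul_mem (D.Xpow (rᶜ \ b.1)) hxN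
  rw [e, Finset.smul_sum, Finset.sum_eq_single b] at hmem
  · obtain ⟨c, hc, ec⟩ := D.Xpow_mul_Xpow (a := rᶜ \ b.1) (b := b.1) Finset.sdiff_disjoint
    rw [smul_algebra_smul_comm, smul_smul, ec, Finset.sdiff_union_of_subset hbr, smul_assoc,
      smul_smul] at hmem
    have := (N.restrictScalars ℂ).smul_mem (f b * c)⁻¹ hmem
    rwa [smul_smul, inv_mul_cancel₀ (mul_ne_zero hfb hc), one_smul] at this
  · intro b' _ hbb'
    by_cases hf : f b' = 0
    · simp [hf]
    rw [smul_algebra_smul_comm, smul_smul, Xpow_mul_Xpow_of_not_disjoint, zero_smul, smul_zero]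
    intro hdis
    have hle : b'.1 ⊆ b.1 := by
      intro k hk
      by_contra hkb
      refine Finset.disjoint_left.1 hdis (Finset.mem_sdiff.2 ⟨?_, hkb⟩) hk
      exact Finset.mem_compl.2 fun hkr => Finset.disjoint_left.1 b'.2 hk hkr
    refine hbb' (le_antisymm hle ?_)
    exact hb.le_of_le (Finset.mem_filter.2 ⟨Finset.mem_univ _, hf⟩) hle
  · simp

theorem IsGen.isIndecomposable {r : Finset (Fin t)} {μ : D.Z} {n : M} (hn : IsGen r μ n) :
    Module.IsIndecomposable D.H ↥(Submodule.span D.H {n}) := by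
  refine ⟨⟨⟨n, Submodule.mem_span_singleton_self n⟩, 0,
    fun h => hn.ne_zero (congrArg Subtype.val h)⟩, fun N N' hNN' => ?_⟩
  by_contra! hcon
  have key : ∀ N : Submodule D.H ↥(Submodule.span D.H {n}), N ≠ ⊥ →
      ∃ hm : D.Xpow rᶜ • n ∈ Submodule.span D.H {n},
        (⟨D.Xpow rᶜ • n, hm⟩ : Submodule.span D.H {n}) ∈ N := by
    intro N hN
    have := hn.Xpow_compl_smul_mem (Submodule.map_subtype_le _ N)
      (fun h => hN
        (Submodule.map_injective_of_injective (Submodule.subtype_injective _)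
          (h.trans (Submodule.map_bot _).symm)))
    obtain ⟨y, hy, e⟩ := Submodule.mem_map.1 this
    refine ⟨e ▸ y.2, ?_⟩
    convert hy
    exact e.symm
  obtain ⟨hm, h1⟩ := key N hcon.1
  obtain ⟨_, h2⟩ := key N' hcon.2
  have h0 := congrArg Subtype.val (Submodule.disjoint_def.1 hNN'.disjoint _ h1 h2)
  exact hn.indep.ne_zero ⟨rᶜ, disjoint_compl_left⟩ h0

theorem IsGen.finrank_span {μ : D.Z} {n : M} (hn : IsGen Finset.univ μ n) :
    Module.finrank ℂ ↥(Submodule.span D.H {n}) = 1 := by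
  have h : (Submodule.span D.H {n}).restrictScalars ℂ = Submodule.span ℂ {n} := by
    refine hn.span_restrictScalars.trans (congrArg _ (Set.ext fun x => ?_))
    constructor
    · rintro ⟨⟨b, hb⟩, rfl⟩
      have : b = ∅ := disjoint_top.1 hb
      simp [this, Xpow_empty]
    · rintro rfl
      exact ⟨⟨∅, Finset.disjoint_empty_left _⟩, by simp [Xpow_empty]⟩
  change Module.finrank ℂ ↥((Submodule.span D.H {n}).restrictScalars ℂ) = 1
  rw [h, finrank_span_singleton hn.ne_zero]

/-! ### The radical of a cyclic module generated by a weight vector -/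

/-- The vectors killed by all `X_k` form a submodule, and it is nonzero as the `X_k` are
nilpotent. -/
theorem X_smul_eq_zero_of_isSimpleModule [IsSimpleModule D.H M] (k : Fin t) (x : M) :
    D.X k • x = 0 := by
  let N : Submodule ℂ M := ⨅ k, LinearMap.ker (Algebra.lsmul ℂ ℂ M (D.X k))
  have hN : ∀ x, x ∈ N ↔ ∀ k, D.X k • x = 0 := by simp [N]
  let N' : Submodule D.H M :=
    { N with
      smul_mem' := fun h x hx => by
        refine D.mem_of_left_mul N (fun v y hy => ?_) (fun l y hy => ?_) h x hx
        · rw [hN] at hy ⊢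
          intro k
          rw [smul_smul, X_mul_Kpow, smul_assoc, mul_smul, hy, smul_zero, smul_zero]
        · rw [(hN y).1 hy l]
          exact N.zero_mem }
  suffices N' = ⊤ from (hN x).1 (show x ∈ N' from this ▸ Submodule.mem_top) k
  refine (eq_bot_or_eq_top N').resolve_left ?_
  have : Nontrivial M := IsSimpleModule.nontrivial D.H M
  obtain ⟨y, hy⟩ := exists_ne (0 : M)
  classical
  have hne : (Finset.univ.filter fun b => D.Xpow b • y ≠ 0).Nonempty :=
    ⟨∅, by simpa [Xpow_empty] using hy⟩
  -- For `b` maximal with `X^b y ≠ 0`, the vector `X^b y` is killed by all `X_k`.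
  obtain ⟨b, hb⟩ := Finset.exists_maximal hne
  refine (Submodule.ne_bot_iff _).2 ⟨D.Xpow b • y, (hN _).2 fun k => ?_,
    (Finset.mem_filter.1 hb.prop).2⟩
  by_cases hk : k ∈ b
  · rw [smul_smul, D.X_mul_Xpow_of_mem hk, zero_smul]
  · obtain ⟨c, -, e⟩ := D.X_mul_Xpow hk
    have : D.Xpow (insert k b) • y = 0 := by
      by_contra hcon
      have := hb.le_of_ge (Finset.mem_filter.2 ⟨Finset.mem_univ _, hcon⟩)
        (Finset.subset_insert k b)
      exact hk (this (Finset.mem_insert_self k b))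
    rw [smul_smul, e, smul_assoc, this, smul_zero]

theorem X_smul_mem_jacobson (k : Fin t) (x : M) : D.X k • x ∈ Module.jacobson D.H M := by
  rw [Module.jacobson, Submodule.mem_sInf]
  intro m hm
  have : IsSimpleModule D.H (M ⧸ m) := isSimpleModule_iff_isCoatom.2 hm
  rw [← Submodule.Quotient.mk_eq_zero, Submodule.Quotient.mk_smul]
  exact X_smul_eq_zero_of_isSimpleModule k _

/-- `X^{(1,…,1)}` kills the radical of `H n`: the radical lies in the maximal submodule generated
by the `X_k n`. So it does not contain `n`. -/
theorem IsGen.notMem_jacobson {μ : D.Z} {n : M} (hn : IsGen ∅ μ n)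
    (htop : Submodule.span D.H {n} = ⊤) : n ∉ Module.jacobson D.H M := by
  set R := Submodule.span D.H (Set.range fun k => D.X k • n) with hR
  have hnR : n ∉ R := by
    intro hcon
    have hle : ∀ x ∈ R, D.Xpow Finset.univ • x = 0 := by
      intro x hx
      let N : Submodule ℂ M := LinearMap.ker (Algebra.lsmul ℂ ℂ M (D.Xpow Finset.univ))
      have hX : ∀ k (y : M), D.X k • y ∈ N := fun k y => by
        change D.Xpow Finset.univ • D.X k • y = 0
        rw [smul_smul, D.Xpow_mul_X_of_mem (Finset.mem_univ k), zero_smul]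
      change x ∈ N
      induction hx using Submodule.span_induction with
      | mem x hx => obtain ⟨k, rfl⟩ := hx; exact hX k n
      | zero => exact N.zero_mem
      | add x y _ _ hx hy => exact N.add_mem hx hy
      | smul h x _ hx =>
        refine D.mem_of_left_mul N (fun v y hy => ?_) (fun k y _ => hX k y) h x hx
        change D.Xpow Finset.univ • D.Kpow v • y = 0
        have e := D.Kpow_mul_Xpow v Finset.univ
        rw [smul_smul, ← one_smul ℂ (D.Xpow Finset.univ * D.Kpow v),
          ← inv_mul_cancel₀ (D.xi_ne_zero (v * D.ell Finset.univ)), mul_smul, ← e, smul_assoc,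
          mul_smul, show D.Xpow Finset.univ • y = 0 from hy, smul_zero, smul_zero]
    exact hn.indep.ne_zero ⟨Finset.univ, Finset.disjoint_empty_right _⟩ (hle n hcon)
  have hgen : IsGen Finset.univ μ (R.mkQ n) := by
    refine isGen_univ (fun v => ?_) (fun k => ?_) ?_
    · rw [← map_smul, hn.weight v]; rfl
    · rw [← map_smul, Submodule.mkQ_apply, Submodule.Quotient.mk_eq_zero]
      exact Submodule.subset_span ⟨k, rfl⟩
    · rwa [Ne, Submodule.mkQ_apply, Submodule.Quotient.mk_eq_zero]
  have hspan : Submodule.span D.H {R.mkQ n} = ⊤ := by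
    rw [← Set.image_singleton, Submodule.span_image, htop, Submodule.map_top, Submodule.range_mkQ]
  have hfin := hgen.finrank_span
  rw [hspan] at hfin
  have hsimple : IsSimpleModule D.H (⊤ : Submodule D.H (M ⧸ R)) :=
    (isSimpleModule_iff ..).2 (is_simple_module_of_finrank_eq_one (K := ℂ) hfin)
  have : IsSimpleModule D.H (M ⧸ R) := IsSimpleModule.congr Submodule.topEquiv.symm
  exact fun h => hnR (Submodule.mem_sInf.1 h R (isSimpleModule_iff_isCoatom.1 this))

theorem IsGen.mk_jacobson {μ : D.Z} {n : M} (hn : IsGen ∅ μ n)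
    (htop : Submodule.span D.H {n} = ⊤) :
    IsGen Finset.univ μ ((Module.jacobson D.H M).mkQ n) := by
  refine isGen_univ (fun v => ?_) (fun k => ?_) ?_
  · rw [← map_smul, hn.weight v]; rfl
  · rw [← map_smul, Submodule.mkQ_apply, Submodule.Quotient.mk_eq_zero]
    exact X_smul_mem_jacobson k n
  · rw [Ne, Submodule.mkQ_apply, Submodule.Quotient.mk_eq_zero]
    exact hn.notMem_jacobson htop

end Cyclic

end NenciuDatum

end


noncomputable section

/-! ### The adjoint representation on monomials -/

instance {R A : Type*} [CommRing R] [Ring A] [HopfAlgebra R A] :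
    IsScalarTower R A (AdjointRep R A) :=
  ⟨fun c a x => by
    change HopfAlgebra.adjointAction R A (c • a) x = c • HopfAlgebra.adjointAction R A a x
    rw [map_smul]; rfl⟩

namespace NenciuDatum

variable {s t : ℕ} (D : NenciuDatum s t)

theorem adjointAction_Kpow (v : D.Z) (x : D.H) :
    HopfAlgebra.adjointAction ℂ D.H (D.Kpow v) x = D.Kpow v * x * D.Kpow (-v) := by
  have h : Bialgebra.comulAlgHom ℂ D.H (D.Kpow v) = D.Kpow v ⊗ₜ D.Kpow v := D.comulHom_Kpow v
  have h' : HopfAlgebra.antipode ℂ (D.Kpow v) = D.Kpow (-v) := D.antipodeHom_Kpow v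
  simp [HopfAlgebra.adjointAction, HopfAlgebra.rmulAntipode, HopfAlgebra.antipodeAlgHomOp,
    -Bialgebra.comulAlgHom_apply, h, h', mul_assoc]

/-- The monomial `X^a L^{-a} K^w` in the adjoint representation. -/
def adjMonomial (a : Finset (Fin t)) (w : D.Z) : AdjointRep ℂ D.H :=
  AdjointRep.of ℂ D.H (D.Xpow a * D.Linv a * D.Kpow w)

theorem adjMonomial_eq (a : Finset (Fin t)) (w : D.Z) :
    D.adjMonomial a w = AdjointRep.of ℂ D.H (D.Xpow a * D.Kpow (-∑ k ∈ a, D.u k + w)) := by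
  rw [adjMonomial, Linv, mul_assoc, ← Kpow_add]

theorem adjMonomial_isWeight (a : Finset (Fin t)) (w : D.Z) :
    IsWeight (D.ell a) (D.adjMonomial a w) := by
  intro v
  rw [adjMonomial_eq, AdjointRep.smul_of, adjointAction_Kpow, ← map_smul, ← mul_assoc,
    Kpow_mul_Xpow, smul_mul_assoc, smul_mul_assoc, mul_assoc, mul_assoc,
    (D.Kpow_commute _ (-v)).eq, ← mul_assoc (D.Kpow v), Kpow_mul_neg, one_mul]

/-- Since `X^a L^{-a} X_k = X_k X^a L^{-a}`, only commuting `X_k` past `K^w` contributes to the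
commutator. -/
theorem X_smul_adjMonomial (k : Fin t) (a : Finset (Fin t)) (w : D.Z) :
    D.X k • D.adjMonomial a w = (1 - D.xi (w * D.d k)) •
      AdjointRep.of ℂ D.H (D.X k * D.Xpow a * D.Kpow (-∑ l ∈ a, D.u l + w - D.u k)) := by
  have h : D.Xpow a * D.Kpow (-∑ l ∈ a, D.u l + w) * D.X k =
      D.xi (w * D.d k) • (D.X k * D.Xpow a * D.Kpow (-∑ l ∈ a, D.u l + w)) := by
    rw [mul_assoc, Kpow_X, mul_smul_comm, ← mul_assoc, Xpow_mul_X, smul_mul_assoc, smul_smul,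
      ← xi_add, ← add_mul]
    congr 3; abel
  rw [adjMonomial_eq, AdjointRep.smul_of, adjointAction_X, h, ← mul_assoc, ← map_smul,
    ← one_smul ℂ (D.X k * D.Xpow a * D.Kpow _), smul_smul, ← sub_smul, mul_one, smul_mul_assoc,
    mul_assoc, mul_assoc, ← Kpow_add, ← sub_eq_add_neg, mul_assoc]

theorem linearIndependent_adjMonomial :
    LinearIndependent ℂ fun x : Finset (Fin t) × D.Z => D.adjMonomial x.1 x.2 := by
  have hinj : Function.Injective
      fun x : Finset (Fin t) × D.Z => (x.1, -∑ k ∈ x.1, D.u k + x.2) := by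
    rintro ⟨a, v⟩ ⟨b, w⟩ h
    obtain ⟨rfl, h⟩ := Prod.mk.inj h
    exact Prod.ext rfl (add_left_cancel h)
  have h := (D.linearIndependent_Xpow_mul_Kpow.comp _ hinj).map' (AdjointRep.of ℂ D.H).toLinearMap
    (AdjointRep.of ℂ D.H).ker
  have e : (fun x : Finset (Fin t) × D.Z => D.adjMonomial x.1 x.2) = (AdjointRep.of ℂ D.H) ∘
      (fun x : Finset (Fin t) × D.Z => D.Xpow x.1 * D.Kpow x.2) ∘
        fun x => (x.1, -∑ k ∈ x.1, D.u k + x.2) := funext fun x => D.adjMonomial_eq x.1 x.2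
  rw [e]
  exact h

theorem span_Xpow_mul_Kpow :
    Submodule.span ℂ (Set.range fun x : Finset (Fin t) × D.Z => D.Xpow x.1 * D.Kpow x.2) = ⊤ := by
  set N := Submodule.span ℂ
    (Set.range fun x : Finset (Fin t) × D.Z => D.Xpow x.1 * D.Kpow x.2) with hN
  have hmem : ∀ a v, D.Xpow a * D.Kpow v ∈ N := fun a v => Submodule.subset_span ⟨(a, v), rfl⟩
  have hstep : ∀ g : D.H, (∀ a v, g * (D.Xpow a * D.Kpow v) ∈ N) → ∀ x ∈ N, g • x ∈ N := by
    intro g hg x hx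
    have : N ≤ N.comap (LinearMap.mulLeft ℂ g) := by
      conv_lhs => rw [hN]
      rw [Submodule.span_le]
      rintro _ ⟨b, rfl⟩
      exact hg b.1 b.2
    exact this hx
  refine Submodule.eq_top_iff'.2 fun h => ?_
  have := D.mem_of_left_mul N (fun w => hstep _ fun a v => ?_) (fun k => hstep _ fun a v => ?_) h 1
    (by simpa [Xpow_empty, Kpow_zero] using hmem ∅ 0)
  · simpa using this
  · rw [← mul_assoc, Kpow_mul_Xpow, smul_mul_assoc, mul_assoc, ← Kpow_add]
    exact N.smul_mem _ (hmem _ _)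
  · by_cases hk : k ∈ a
    · rw [← mul_assoc, D.X_mul_Xpow_of_mem hk, zero_mul]
      exact N.zero_mem
    · obtain ⟨c, -, e⟩ := D.X_mul_Xpow hk
      rw [← mul_assoc, e, smul_mul_assoc]
      exact N.smul_mem _ (hmem _ _)

theorem span_adjMonomial :
    Submodule.span ℂ (Set.range fun x : Finset (Fin t) × D.Z => D.adjMonomial x.1 x.2) = ⊤ := by
  have h := congrArg (Submodule.map (AdjointRep.of ℂ D.H).toLinearMap) D.span_Xpow_mul_Kpow
  rw [Submodule.map_span, Submodule.map_top, LinearEquiv.range] at h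
  refine top_le_iff.1 (h.symm.le.trans (Submodule.span_mono ?_))
  rintro _ ⟨_, ⟨⟨a, v⟩, rfl⟩, rfl⟩
  refine ⟨(a, ∑ k ∈ a, D.u k + v), ?_⟩
  change D.adjMonomial _ _ = _
  rw [adjMonomial_eq, neg_add_cancel_left]
  rfl

theorem mem_rvec {w : D.Z} {k : Fin t} : k ∈ D.rvec w ↔ D.xi (w * D.d k) = 1 := by
  have h0 : D.X k * D.Kpow w ≠ 0 := by
    obtain ⟨c, hc, e⟩ := D.Xpow_singleton k
    rw [e, smul_mul_assoc]
    exact smul_ne_zero hc (D.linearIndependent_Xpow_mul_Kpow.ne_zero ({k}, w))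
  simp only [rvec, Finset.mem_filter, Finset.mem_univ, true_and]
  rw [commute_iff_eq, Kpow_X, eq_comm]
  conv_lhs => rhs; rw [← one_smul ℂ (D.X k * D.Kpow w)]
  exact smul_left_injective ℂ h0 |>.eq_iff

theorem X_smul_adjMonomial_of_mem_rvec {k : Fin t} {w : D.Z} (hk : k ∈ D.rvec w)
    (a : Finset (Fin t)) : D.X k • D.adjMonomial a w = 0 := by
  rw [X_smul_adjMonomial, D.mem_rvec.1 hk, sub_self, zero_smul]

theorem X_smul_adjMonomial_of_notMem {k : Fin t} {a : Finset (Fin t)} (hk : k ∉ a) (w : D.Z) :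
    ∃ c : ℂ, (k ∉ D.rvec w → c ≠ 0) ∧
      D.X k • D.adjMonomial a w = c • D.adjMonomial (insert k a) w := by
  obtain ⟨c, hc, e⟩ := D.X_mul_Xpow hk
  refine ⟨(1 - D.xi (w * D.d k)) * c, fun hkw => mul_ne_zero ?_ hc, ?_⟩
  · rw [mem_rvec] at hkw
    exact sub_ne_zero.2 (Ne.symm hkw)
  · rw [X_smul_adjMonomial, e, mul_smul, adjMonomial_eq, smul_mul_assoc, map_smul,
      Finset.sum_insert hk]
    congr 5; abel

theorem Xpow_smul_adjMonomial {b c : Finset (Fin t)} {w : D.Z} (hb : Disjoint b (D.rvec w))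
    (hbc : Disjoint b c) :
    ∃ z : ℂ, z ≠ 0 ∧ D.Xpow b • D.adjMonomial c w = z • D.adjMonomial (b ∪ c) w := by
  induction b using Finset.induction_on with
  | empty => exact ⟨1, one_ne_zero, by simp [Xpow_empty]⟩
  | insert k b hk ih =>
    rw [Finset.disjoint_insert_left] at hb hbc
    obtain ⟨z, hz, e⟩ := ih hb.2 hbc.2
    obtain ⟨z', hz', e'⟩ := D.Xpow_insert hk
    obtain ⟨z₂, hz₂, e₂⟩ := D.X_smul_adjMonomial_of_notMem (k := k) (a := b ∪ c)
      (by simp [hk, hbc.1]) w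
    refine ⟨z' * z * z₂, mul_ne_zero (mul_ne_zero hz' hz) (hz₂ hb.1), ?_⟩
    rw [e', smul_assoc, mul_smul, e, smul_algebra_smul_comm, e₂, smul_smul, smul_smul,
      Finset.insert_union, mul_assoc]

/-- `X^c L^{-c} K^w`, with `c ⊆ r(w)`, is killed by the `X_k` with `k ∈ r(w)`, and the other `X_k`
act on it freely. -/
theorem isGen_adjMonomial {c : Finset (Fin t)} {w : D.Z} (hc : c ⊆ D.rvec w) :
    IsGen (D.rvec w) (D.ell c) (D.adjMonomial c w) where
  weight := D.adjMonomial_isWeight c w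
  kill k hk := D.X_smul_adjMonomial_of_mem_rvec hk c
  indep := by
    have hdis : ∀ b : {b : Finset (Fin t) // Disjoint b (D.rvec w)}, Disjoint b.1 c :=
      fun b => Finset.disjoint_of_subset_right hc b.2
    choose z hz e using fun b : {b : Finset (Fin t) // Disjoint b (D.rvec w)} =>
      D.Xpow_smul_adjMonomial b.2 (hdis b)
    have hinj : Function.Injective
        fun b : {b : Finset (Fin t) // Disjoint b (D.rvec w)} => (b.1 ∪ c, w) := by
      intro b b' h
      have h' := congrArg (fun x => x.1 \ c) h
      simp only [Finset.union_sdiff_right] at h'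
      rw [Finset.sdiff_eq_self_of_disjoint (hdis b), Finset.sdiff_eq_self_of_disjoint (hdis b')]
        at h'
      exact Subtype.ext h'
    have h := (D.linearIndependent_adjMonomial.comp _ hinj).units_smul
      fun b => Units.mk0 (z b) (hz b)
    rw [funext e]
    exact h

/-- The generator of `V_p^r` has weight `l(r) + p`, and only the `X_k` with `k ∈ r` kill it. -/
theorem isGen_Xpow_mul_omega (r : Finset (Fin t)) (p : D.Z) :
    IsGen r (D.ell r + p) (D.Xpow r * D.omega p) where
  weight := (D.omega_isWeight p).Xpow_smul r
  kill k hk := by rw [smul_eq_mul, ← mul_assoc, D.X_mul_Xpow_of_mem hk, zero_mul]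
  indep := by
    choose z hz e using fun b : {b : Finset (Fin t) // Disjoint b r} => D.Xpow_mul_Xpow b.2
    have hinj : Function.Injective fun b : {b : Finset (Fin t) // Disjoint b r} => b.1 ∪ r := by
      intro b b' h
      have h' := congrArg (fun x => x \ r) h
      simp only [Finset.union_sdiff_right] at h'
      rw [Finset.sdiff_eq_self_of_disjoint b.2, Finset.sdiff_eq_self_of_disjoint b'.2] at h'
      exact Subtype.ext h'
    have h := ((D.linearIndependent_Xpow_mul_omega p).comp _ hinj).units_smul
      fun b => Units.mk0 (z b) (hz b)
    have e' : ∀ b : {b : Finset (Fin t) // Disjoint b r}, D.Xpow b.1 • (D.Xpow r * D.omega p) =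
        z b • (D.Xpow (b.1 ∪ r) * D.omega p) := fun b => by
      rw [smul_eq_mul, ← mul_assoc, e, smul_mul_assoc]
    rw [funext e']
    exact h

/-! ### The decomposition of the adjoint representation -/

/-- Submodules contained in the spans of the fibres of a map on the index set of a linearly
independent family are independent. -/
theorem _root_.LinearIndependent.iSupIndep_of_fiber {R A M ι κ : Type*} [Ring R] [Ring A]
    [AddCommGroup M] [Module R M] [Module A M] {v : ι → M} (hv : LinearIndependent R v)
    (f : ι → κ) (Q : κ → Submodule A M)
    (hQ : ∀ j, ∀ x ∈ Q j, x ∈ Submodule.span R (v '' (f ⁻¹' {j}))) : iSupIndep Q := by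
  intro j
  rw [Submodule.disjoint_def]
  intro x hx hx'
  have hdis := hv.disjoint_span_image (s := f ⁻¹' {j}) (t := f ⁻¹' {j}ᶜ)
    (by rw [Set.preimage_compl]; exact disjoint_compl_right)
  refine Submodule.disjoint_def.1 hdis x (hQ j x hx) ?_
  rw [iSup_subtype'] at hx'
  clear hx
  induction hx' using Submodule.iSup_induction' with
  | mem i y hy =>
    refine Submodule.span_mono (Set.image_mono (Set.preimage_mono ?_)) (hQ i y hy)
    simpa [eq_comm] using i.2
  | zero => exact Submodule.zero_mem _
  | add y z _ _ hy hz => exact Submodule.add_mem _ hy hz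

theorem _root_.iSupIndep.nonempty_equiv_directSum {A M ι : Type*} [Ring A] [AddCommGroup M]
    [Module A M] {Q : ι → Submodule A M} (hQ : iSupIndep Q) {P : Submodule A M}
    (hP : ⨆ i, Q i = P) {N : ι → Type*} [∀ i, AddCommGroup (N i)] [∀ i, Module A (N i)]
    (h : ∀ i, Nonempty (↥(Q i) ≃ₗ[A] N i)) : Nonempty (↥P ≃ₗ[A] ⨁ i, N i) := by
  classical
  subst hP
  have hinj : Function.Injective (DirectSum.coeLinearMap Q) := hQ.dfinsupp_lsum_injective
  exact ⟨(LinearEquiv.ofEq _ _ DirectSum.range_coeLinearMap).symm ≪≫ₗ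
    (LinearEquiv.ofInjective _ hinj).symm ≪≫ₗ DirectSum.congrLinearEquiv fun i => (h i).some⟩

/-- The submodule of the adjoint representation generated by `X^c L^{-c} K^w`. -/
def adjCyclic (w : D.Z) (c : Finset (Fin t)) : Submodule D.H (AdjointRep ℂ D.H) :=
  Submodule.span D.H {D.adjMonomial c w}

theorem adjMonomial_mem_contribution (a : Finset (Fin t)) (w : D.Z) :
    D.adjMonomial a w ∈ D.contribution w :=
  Submodule.subset_span ⟨a, rfl⟩

theorem contribution_le_span (w : D.Z) (x : AdjointRep ℂ D.H) (hx : x ∈ D.contribution w) :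
    x ∈ Submodule.span ℂ (Set.range fun a => D.adjMonomial a w) := by
  set N := Submodule.span ℂ (Set.range fun a => D.adjMonomial a w) with hN
  have hmem : ∀ a, D.adjMonomial a w ∈ N := fun a => Submodule.subset_span ⟨a, rfl⟩
  have hstep : ∀ g : D.H, (∀ a, g • D.adjMonomial a w ∈ N) → ∀ x ∈ N, g • x ∈ N := by
    intro g hg x hx
    have : N ≤ N.comap (Algebra.lsmul ℂ ℂ _ g) := by
      conv_lhs => rw [hN]
      rw [Submodule.span_le]
      rintro _ ⟨a, rfl⟩
      exact hg a
    exact this hx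
  induction hx using Submodule.span_induction with
  | mem x hx => obtain ⟨a, rfl⟩ := hx; exact hmem a
  | zero => exact N.zero_mem
  | add x y _ _ hx hy => exact N.add_mem hx hy
  | smul h x _ hx =>
    refine D.mem_of_left_mul N (fun v => hstep _ fun a => ?_) (fun k => hstep _ fun a => ?_) h x hx
    · rw [D.adjMonomial_isWeight a w v]
      exact N.smul_mem _ (hmem a)
    · by_cases hk : k ∈ a
      · rw [X_smul_adjMonomial, D.X_mul_Xpow_of_mem hk, zero_mul, map_zero, smul_zero]
        exact N.zero_mem
      · obtain ⟨c, -, e⟩ := D.X_smul_adjMonomial_of_notMem hk w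
        rw [e]
        exact N.smul_mem _ (hmem _)

theorem iSup_adjCyclic (w : D.Z) :
    ⨆ c : {c : Finset (Fin t) // c ⊆ D.rvec w}, D.adjCyclic w c.1 = D.contribution w := by
  refine le_antisymm (iSup_le fun c => ?_) ?_
  · rw [adjCyclic, Submodule.span_singleton_le_iff_mem]
    exact D.adjMonomial_mem_contribution c.1 w
  · rw [contribution, Submodule.span_le]
    rintro _ ⟨a, rfl⟩
    change D.adjMonomial a w ∈ _
    obtain ⟨z, hz, e⟩ := D.Xpow_smul_adjMonomial (b := a \ D.rvec w) (c := a ∩ D.rvec w) (w := w)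
      Finset.sdiff_disjoint (Finset.disjoint_sdiff_inter a (D.rvec w))
    rw [Finset.sdiff_union_inter] at e
    have h : D.adjMonomial a w =
        (z⁻¹ • D.Xpow (a \ D.rvec w)) • D.adjMonomial (a ∩ D.rvec w) w := by
      rw [smul_assoc, e, smul_smul, inv_mul_cancel₀ hz, one_smul]
    rw [h]
    refine Submodule.smul_mem _ _ (Submodule.mem_iSup_of_mem
      (⟨a ∩ D.rvec w, Finset.inter_subset_right⟩ : {c : Finset (Fin t) // c ⊆ D.rvec w}) ?_)
    exact Submodule.mem_span_singleton_self _

theorem iSupIndep_adjCyclic (w : D.Z) :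
    iSupIndep fun c : {c : Finset (Fin t) // c ⊆ D.rvec w} => D.adjCyclic w c.1 := by
  refine D.linearIndependent_adjMonomial.iSupIndep_of_fiber
    (fun x => (⟨x.1 ∩ D.rvec w, Finset.inter_subset_right⟩ : {c : Finset (Fin t) // c ⊆ D.rvec w}))
    _ ?_
  rintro ⟨c, hc⟩ x hx
  change x ∈ (Submodule.span D.H {D.adjMonomial c w}).restrictScalars ℂ at hx
  rw [(D.isGen_adjMonomial hc).span_restrictScalars] at hx
  refine Submodule.span_le.2 ?_ hx
  rintro _ ⟨⟨b, hb⟩, rfl⟩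
  obtain ⟨z, -, e⟩ := D.Xpow_smul_adjMonomial hb (Finset.disjoint_of_subset_right hc hb)
  simp only [e]
  refine Submodule.smul_mem _ _ (Submodule.subset_span ⟨(b ∪ c, w), ?_, rfl⟩)
  simp [Finset.union_inter_distrib_right, Finset.disjoint_iff_inter_eq_empty.1 hb,
    Finset.inter_eq_left.2 hc]

theorem contribution_isInternal : DirectSum.IsInternal D.contribution := by
  refine DirectSum.isInternal_submodule_of_iSupIndep_of_iSup_eq_top ?_ ?_
  · refine D.linearIndependent_adjMonomial.iSupIndep_of_fiber (fun x => x.2) _ fun w x hx => ?_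
    refine Submodule.span_mono ?_ (D.contribution_le_span w x hx)
    rintro _ ⟨a, rfl⟩
    exact ⟨(a, w), rfl, rfl⟩
  · refine Submodule.eq_top_iff'.2 fun x => ?_
    have hx : x ∈ (⊤ : Submodule ℂ (AdjointRep ℂ D.H)) := Submodule.mem_top
    rw [← D.span_adjMonomial] at hx
    refine (Submodule.span_le (p := (⨆ w, D.contribution w).restrictScalars ℂ)).2 ?_ hx
    rintro _ ⟨⟨a, w⟩, rfl⟩
    exact Submodule.mem_iSup_of_mem w (D.adjMonomial_mem_contribution a w)

/-- The contribution of `K^w` is the direct sum of the cyclic modules generated by the monomials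
`X^c L^{-c} K^w` with `c ⊆ r(w)`; modules isomorphic to them may be used instead, in any order. -/
theorem nonempty_contribution_equiv (w : D.Z) {ι : Type*}
    (e : ι ≃ {c : Finset (Fin t) // c ⊆ D.rvec w})
    {N : ι → Type*} [∀ i, AddCommGroup (N i)] [∀ i, Module D.H (N i)]
    (h : ∀ i, Nonempty (↥(D.adjCyclic w (e i).1) ≃ₗ[D.H] N i)) :
    Nonempty (↥(D.contribution w) ≃ₗ[D.H] ⨁ i, N i) := by
  let Q : ι → Submodule D.H (AdjointRep ℂ D.H) := fun i => D.adjCyclic w (e i).1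
  have hind : iSupIndep Q := (D.iSupIndep_adjCyclic w).comp e.injective
  have hsup : ⨆ i, Q i = D.contribution w := by
    rw [← D.iSup_adjCyclic w]
    exact e.surjective.iSup_comp fun c => D.adjCyclic w c.1
  exact hind.nonempty_equiv_directSum hsup h

/-! ### Identification of the summands -/

/-- Complementation on the subsets of `r`. -/
def sdiffEquiv (r : Finset (Fin t)) :
    {c : Finset (Fin t) // c ⊆ r} ≃ {c : Finset (Fin t) // c ⊆ r} where
  toFun c := ⟨r \ c.1, Finset.sdiff_subset⟩
  invFun c := ⟨r \ c.1, Finset.sdiff_subset⟩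
  left_inv c := Subtype.ext (Finset.sdiff_sdiff_eq_self c.2)
  right_inv c := Subtype.ext (Finset.sdiff_sdiff_eq_self c.2)

theorem ell_sdiff {c r : Finset (Fin t)} (hc : c ⊆ r) : D.ell (r \ c) = D.ell r + -D.ell c := by
  rw [← sub_eq_add_neg, eq_sub_iff_add_eq]
  exact Finset.sum_sdiff hc

theorem nonempty_adjCyclic_equiv_V (w : D.Z) {c : Finset (Fin t)} (hc : c ⊆ D.rvec w) :
    Nonempty (↥(D.adjCyclic w (D.rvec w \ c)) ≃ₗ[D.H] ↥(D.V (D.rvec w) (-D.ell c))) := by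
  have h := D.isGen_adjMonomial (w := w) (c := D.rvec w \ c) Finset.sdiff_subset
  rw [D.ell_sdiff hc] at h
  exact h.nonempty_equiv (D.isGen_Xpow_mul_omega (D.rvec w) (-D.ell c))

theorem nonempty_contribution_equiv_V (w : D.Z) :
    Nonempty (↥(D.contribution w) ≃ₗ[D.H]
      ⨁ c : {c : Finset (Fin t) // c ⊆ D.rvec w}, ↥(D.V (D.rvec w) (-D.ell c))) :=
  D.nonempty_contribution_equiv w (sdiffEquiv _) fun c => D.nonempty_adjCyclic_equiv_V w c.2

theorem V_isIndecomposable (r : Finset (Fin t)) (p : D.Z) :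
    Module.IsIndecomposable D.H ↥(D.V r p) :=
  (D.isGen_Xpow_mul_omega r p).isIndecomposable

theorem isGen_omega (p : D.Z) : IsGen ∅ p (D.omega p) := by
  simpa [Xpow_empty, ell] using D.isGen_Xpow_mul_omega ∅ p

/-- `P_p` is a direct summand of `H`, as `ω_p` is idempotent. -/
theorem P_projective (p : D.Z) : Module.Projective D.H ↥(D.P p) := by
  have hmem : D.omega p ∈ D.P p := Submodule.mem_span_singleton_self _
  refine Module.Projective.of_split (D.P p).subtype
    (LinearMap.toSpanSingleton D.H _ ⟨D.omega p, hmem⟩) (LinearMap.ext fun x => ?_)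
  obtain ⟨h, hh⟩ := Submodule.mem_span_singleton.1 x.2
  refine Subtype.ext ?_
  change x.1 * D.omega p = x.1
  rw [← hh, smul_eq_mul, mul_assoc, omega_mul_self]

theorem S_finrank (p : D.Z) : Module.finrank ℂ ↥(D.S p) = 1 :=
  (D.isGen_Xpow_mul_omega Finset.univ p).finrank_span

theorem S_isSimpleModule (p : D.Z) : IsSimpleModule D.H ↥(D.S p) :=
  (isSimpleModule_iff ..).2 (is_simple_module_of_finrank_eq_one (K := ℂ) (D.S_finrank p))

theorem rvec_eq_empty {w : D.Z} (h : ∀ k, ¬ Commute (D.X k) (D.Kpow w)) : D.rvec w = ∅ := by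
  simp [rvec, h]

theorem rvec_eq_univ {w : D.Z} (h : D.Kpow w ∈ Subalgebra.center ℂ D.H) :
    D.rvec w = Finset.univ := by
  have : ∀ k, Commute (D.X k) (D.Kpow w) := fun k => Subalgebra.mem_center_iff.1 h (D.X k)
  simp [rvec, this]

/-- The head of `P_p` is one-dimensional of weight `p`. -/
theorem nonempty_equiv_head {M : Type*} [AddCommGroup M] [Module ℂ M] [Module D.H M]
    [IsScalarTower ℂ D.H M] {p : D.Z} {n : M} (hn : IsGen Finset.univ p n) :
    Nonempty (↥(Submodule.span D.H {n}) ≃ₗ[D.H] D.Head p) := by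
  let n₀ : ↥(D.P p) := ⟨D.omega p, Submodule.mem_span_singleton_self _⟩
  have htop : Submodule.span D.H {n₀} = ⊤ := by
    refine Submodule.eq_top_iff'.2 fun x => ?_
    obtain ⟨h, hh⟩ := Submodule.mem_span_singleton.1 x.2
    exact Submodule.mem_span_singleton.2 ⟨h, Subtype.ext hh⟩
  have hω := D.isGen_omega p
  have hn₀ : IsGen ∅ p n₀ :=
    { weight := fun v => Subtype.ext (hω.weight v)
      kill := by simp
      indep := LinearIndependent.of_comp ((D.P p).subtype.restrictScalars ℂ) hω.indep }
  have hgen := hn₀.mk_jacobson htop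
  have hspan : Submodule.span D.H {(Module.jacobson D.H ↥(D.P p)).mkQ n₀} = ⊤ := by
    rw [← Set.image_singleton, Submodule.span_image, htop, Submodule.map_top, Submodule.range_mkQ]
  obtain ⟨e⟩ := hn.nonempty_equiv hgen
  exact ⟨e ≪≫ₗ LinearEquiv.ofEq _ _ hspan ≪≫ₗ Submodule.topEquiv⟩

end NenciuDatum

end

theorem mainTheorem2 {s t : ℕ} (D : NenciuDatum s t) :
    -- the decomposition of `(H, ▷)`
    Nonempty (AdjointRep ℂ D.H ≃ₗ[D.H]
      ⨁ v : D.Z, ⨁ c : {c : Finset (Fin t) // c ⊆ D.rvec v}, ↥(D.V (D.rvec v) (-D.ell c))) ∧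
    -- all summands are indecomposable
    (∀ v : D.Z, ∀ c : Finset (Fin t), c ⊆ D.rvec v →
      Module.IsIndecomposable D.H ↥(D.V (D.rvec v) (-D.ell c))) ∧
    -- the inner sums are the contributions of the grouplikes
    DirectSum.IsInternal D.contribution ∧
    (∀ w : D.Z, Nonempty (↥(D.contribution w) ≃ₗ[D.H]
      ⨁ c : {c : Finset (Fin t) // c ⊆ D.rvec w}, ↥(D.V (D.rvec w) (-D.ell c)))) ∧
    -- a grouplike that commutes with no `X_k` contributes one projective `P_0`
    (∀ w : D.Z, (∀ k, ¬ Commute (D.X k) (D.Kpow w)) →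
      Nonempty (↥(D.contribution w) ≃ₗ[D.H] ↥(D.P 0))) ∧
    Module.Projective D.H ↥(D.P 0) ∧
    -- a central grouplike contributes `2 ^ t` one-dimensional simples
    (∀ w : D.Z, D.Kpow w ∈ Subalgebra.center ℂ D.H →
      Nonempty (↥(D.contribution w) ≃ₗ[D.H] ⨁ c : Finset (Fin t), ↥(D.S (-D.ell c))) ∧
      Nonempty (↥(D.contribution w) ≃ₗ[D.H] ⨁ c : Finset (Fin t), D.Head (D.ell c))) ∧
    (∀ p : D.Z, IsSimpleModule D.H ↥(D.S p) ∧ Module.finrank ℂ ↥(D.S p) = 1) := by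
  refine ⟨?_, fun v c _ => D.V_isIndecomposable _ _, D.contribution_isInternal,
    D.nonempty_contribution_equiv_V, fun w hw => ?_, D.P_projective 0, fun w hw => ?_,
    fun p => ⟨D.S_isSimpleModule p, D.S_finrank p⟩⟩
  · obtain ⟨e⟩ := D.contribution_isInternal.submodule_iSupIndep.nonempty_equiv_directSum
      D.contribution_isInternal.submodule_iSup_eq_top D.nonempty_contribution_equiv_V
    exact ⟨Submodule.topEquiv.symm ≪≫ₗ e⟩
  · have hr := D.rvec_eq_empty hw
    have hC : D.contribution w = D.adjCyclic w ∅ := by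
      rw [← D.iSup_adjCyclic w]
      refine le_antisymm (iSup_le fun c => ?_)
        (le_iSup_of_le ⟨∅, Finset.empty_subset _⟩ le_rfl)
      have hc : c.1 = ∅ := Finset.subset_empty.1 (c.2.trans hr.le)
      rw [hc]
    have h := D.isGen_adjMonomial (w := w) (Finset.empty_subset _)
    rw [hr] at h
    rw [hC]
    exact h.nonempty_equiv (D.isGen_omega 0)
  · have hr := D.rvec_eq_univ hw
    have hsub : ∀ c : Finset (Fin t), c ⊆ D.rvec w := fun c => hr ▸ Finset.subset_univ c
    let e : Finset (Fin t) ≃ {c : Finset (Fin t) // c ⊆ D.rvec w} :=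
      (Equiv.subtypeUnivEquiv hsub).symm
    refine ⟨D.nonempty_contribution_equiv w (e.trans (NenciuDatum.sdiffEquiv _)) fun c => ?_,
      D.nonempty_contribution_equiv w e fun c => ?_⟩
    · have h := D.nonempty_adjCyclic_equiv_V w (hsub c)
      have hS : D.V (D.rvec w) (-D.ell c) = D.S (-D.ell c) := by rw [hr]; rfl
      rw [hS] at h
      exact h
    · have h := D.isGen_adjMonomial (hsub c)
      rw [hr] at h
      exact D.nonempty_equiv_head h
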